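/- Let $F$ be R. Thompson's group of all piecewise linear increasing homeomorphisms of $[0,1]$ with all slopes powers of $2$ and all break points in $\mathbb{Z}[\frac12]$. A *binary tree* here is a finite or infinite rooted planar binary tree in which every vertex has either no children or both a left and a right child. Label left edges by $0$ and right edges by $1$, and identify every branch (maximal simple path from the root) with its label, a finite or infinite binary word. Branches are ordered from left to right. A *tree-diagram* is a triple $(T_+,T_-,\phi)$, where $T_+,T_-$ are binary trees with the same finite number of infinite branches and $\phi$ is a bijection from the set of branches of $T_+$ to the set of branches of $T_-$ that preserves the left-to-right order and takes infinite branches to infinite branches. It corresponds to the homeomorphism of $[0,1]$ that takes $.u\alpha$ (binary expansion) to $.\phi(u)\alpha$ for every finite branch $u$ of $T_+$ and every infinite binary word $\alpha$, and takes $.\omega$ to $.\phi(\omega)$ for every infinite branch $\omega$ of $T_+$. Let $\mathcal{F}<\mathrm{Homeo}([0,1])$ be the group of all homeomorphisms that correspond to tree-diagrams. Let $\mu$ be Lebesgue measure on $[0,1]$ and let $$\mathrm{dist}_H(f,g)=\mu(\{x: f(x)\ne g(x)\})+\mu(\{x: f^{-1}(x)\ne g^{-1}(x)\})$$ be the Hamming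 metric on $F$. Let $\bar F$ be the (Raĭkov) completion of $F$ with respect to $\mathrm{dist}_H$: the group of $\mathrm{dist}_H$-Cauchy sequences $(f_n)$ of elements of $F$ with termwise operations, where $(f_n)$ and $(g_n)$ are identified if $\lim_{n\to\infty}\mathrm{dist}_H(f_n,g_n)=0$. **Theorem.** The group $\mathcal{F}$ contains a non-abelian free subgroup. Moreover, the completion $\bar F$ of $F$ is non-amenable (as a discrete group), that is, there is no left-invariant finitely additive probability measure defined on all subsets of $\bar F$. -/

import Mathlib

namespace Thompson

/-! ### Thompson's group `F` -/

/-- Finite binary fractions: the elements of `ℤ[1/2]`. -/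
def IsDyadic (x : ℝ) : Prop := ∃ (m : ℤ) (k : ℕ), x = m / 2 ^ k

/-- The piecewise linear increasing homeomorphisms of `[0,1]` with all slopes powers of `2` and all
break points in `ℤ[1/2]`: there is a finite set `S` of dyadic numbers such that the map is linear
with slope a power of `2` on every interval `[a, b]` whose interior contains no element of `S`. -/
def IsThompson (f : unitInterval ≃ₜ unitInterval) : Prop :=
  StrictMono f ∧ ∃ S : Finset unitInterval, (∀ s ∈ S, IsDyadic s) ∧
    ∀ a b : unitInterval, a < b → (∀ s ∈ S, s ∉ Set.Ioo a b) →
      ∃ n : ℤ, ∀ x ∈ Set.Icc a b, (f x : ℝ) = f a + 2 ^ n * ((x : ℝ) - a)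

theorem IsDyadic.add {x y : ℝ} (hx : IsDyadic x) (hy : IsDyadic y) : IsDyadic (x + y) := by
  obtain ⟨m, k, rfl⟩ := hx
  obtain ⟨m', k', rfl⟩ := hy
  refine ⟨m * 2 ^ k' + m' * 2 ^ k, k + k', ?_⟩
  push_cast
  rw [pow_add]
  field_simp

theorem IsDyadic.neg {x : ℝ} (hx : IsDyadic x) : IsDyadic (-x) := by
  obtain ⟨m, k, rfl⟩ := hx
  exact ⟨-m, k, by push_cast; ring⟩

theorem IsDyadic.zpow_mul {x : ℝ} (hx : IsDyadic x) (n : ℤ) : IsDyadic (2 ^ n * x) := by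
  obtain ⟨m, k, rfl⟩ := hx
  obtain ⟨j, rfl | rfl⟩ := n.eq_nat_or_neg
  · exact ⟨m * 2 ^ j, k, by push_cast; rw [zpow_natCast]; ring⟩
  · exact ⟨m, k + j, by rw [zpow_neg, zpow_natCast, pow_add]; field_simp⟩

/-- Induction along the break points. -/
theorem induction_breaks (S : Finset unitInterval) (P : unitInterval → Prop) (h0 : P 0)
    (hstep : ∀ t x, t < x → (t = 0 ∨ t ∈ S) → (∀ s ∈ S, s ∉ Set.Ioo t x) → P t → P x) (x) : P x := by
  classical
  induction hk : (S.filter (· < x)).card using Nat.strong_induction_on generalizing x with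
  | _ k ih =>
    rcases (unitInterval.nonneg' : 0 ≤ x).eq_or_lt with rfl | hx
    · exact h0
    · have hne : (insert 0 (S.filter (· < x))).Nonempty := ⟨0, by simp⟩
      set t := (insert 0 (S.filter (· < x))).max' hne with ht
      have htm : t ∈ insert 0 (S.filter (· < x)) := Finset.max'_mem _ _
      have hmax : ∀ s ∈ S, s < x → s ≤ t := fun s hs hsx =>
        Finset.le_max' _ _ (by simp [hs, hsx])
      rw [Finset.mem_insert, Finset.mem_filter] at htm
      have htx : t < x := by
        rcases htm with h | h
        · rw [h]; exact hx
        · exact h.2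
      refine hstep t x htx (htm.imp id And.left)
        (fun s hs hsI => (hmax s hs hsI.2).not_gt hsI.1) ?_
      rcases htm with h | h
      · rw [h]; exact h0
      · refine ih _ ?_ t rfl
        rw [← hk]
        apply Finset.card_lt_card
        refine ⟨fun s hs => ?_, fun hc => ?_⟩
        · rw [Finset.mem_filter] at hs ⊢
          exact ⟨hs.1, hs.2.trans htx⟩
        · have := hc (Finset.mem_filter.2 h)
          simp at this

theorem IsThompson.map_zero {f : unitInterval ≃ₜ unitInterval} (hf : IsThompson f) : f 0 = 0 := by
  apply le_antisymm _ unitInterval.nonneg'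
  have h := hf.1.monotone (unitInterval.nonneg' : 0 ≤ f.symm 0)
  simpa using h

theorem IsThompson.map_dyadic {f : unitInterval ≃ₜ unitInterval} (hf : IsThompson f)
    {x : unitInterval} (hx : IsDyadic x) : IsDyadic (f x) := by
  obtain ⟨S, hS, hlin⟩ := hf.2
  revert hx
  refine induction_breaks S (fun x => IsDyadic x → IsDyadic (f x)) ?_ ?_ x
  · intro h
    rwa [hf.map_zero]
  · intro t x htx ht hI ih hx
    have htd : IsDyadic t := by
      rcases ht with rfl | ht
      · exact ⟨0, 0, by simp⟩
      · exact hS t ht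
    obtain ⟨n, hn⟩ := hlin t x htx hI
    rw [hn x ⟨htx.le, le_rfl⟩, sub_eq_add_neg]
    exact (ih htd).add ((hx.add htd.neg).zpow_mul n)

theorem IsThompson.one : IsThompson 1 :=
  ⟨fun _ _ h => h, ∅, by simp, fun a b _ _ => ⟨0, fun x _ => by simp⟩⟩

theorem IsThompson.inv {f : unitInterval ≃ₜ unitInterval} (hf : IsThompson f) : IsThompson f⁻¹ := by
  classical
  have hfi : ∀ x, f (f⁻¹ x) = x := f.apply_symm_apply
  have hmono : StrictMono (f⁻¹ : unitInterval ≃ₜ unitInterval) := by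
    intro x y hxy
    rw [← hf.1.lt_iff_lt, hfi, hfi]
    exact hxy
  obtain ⟨S, hS, hlin⟩ := hf.2
  refine ⟨hmono, S.image f, ?_, ?_⟩
  · intro s hs
    obtain ⟨t, ht, rfl⟩ := Finset.mem_image.1 hs
    exact hf.map_dyadic (hS t ht)
  · intro a b hab hI
    obtain ⟨n, hn⟩ := hlin (f⁻¹ a) (f⁻¹ b) (hmono hab) (by
      intro s hs hsI
      refine hI (f s) (Finset.mem_image_of_mem _ hs) ⟨?_, ?_⟩
      · rw [← hfi a]; exact hf.1 hsI.1
      · rw [← hfi b]; exact hf.1 hsI.2)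
    refine ⟨-n, fun x hx => ?_⟩
    have h := hn (f⁻¹ x) ⟨hmono.monotone hx.1, hmono.monotone hx.2⟩
    rw [hfi, hfi] at h
    have h2 : (2 : ℝ) ^ n ≠ 0 := by positivity
    rw [zpow_neg, h]
    field_simp
    ring

theorem IsThompson.mul {f g : unitInterval ≃ₜ unitInterval} (hf : IsThompson f)
    (hg : IsThompson g) : IsThompson (f * g) := by
  classical
  have hgi : ∀ x, g (g⁻¹ x) = x := g.apply_symm_apply
  obtain ⟨S, hS, hlin⟩ := hf.2
  obtain ⟨S', hS', hlin'⟩ := hg.2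
  refine ⟨hf.1.comp hg.1, S' ∪ S.image (g⁻¹ : unitInterval ≃ₜ unitInterval), ?_, ?_⟩
  · intro s hs
    rcases Finset.mem_union.1 hs with hs | hs
    · exact hS' s hs
    · obtain ⟨t, ht, rfl⟩ := Finset.mem_image.1 hs
      exact hg.inv.map_dyadic (hS t ht)
  · intro a b hab hI
    obtain ⟨n, hn⟩ := hlin' a b hab fun s hs => hI s (Finset.mem_union_left _ hs)
    obtain ⟨m, hm⟩ := hlin (g a) (g b) (hg.1 hab) (by
      intro s hs hsI
      refine hI (g⁻¹ s) (Finset.mem_union_right _ (Finset.mem_image_of_mem _ hs)) ⟨?_, ?_⟩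
      · rw [← hg.1.lt_iff_lt, hgi]; exact hsI.1
      · rw [← hg.1.lt_iff_lt, hgi]; exact hsI.2)
    refine ⟨m + n, fun x hx => ?_⟩
    rw [Homeomorph.mul_apply, Homeomorph.mul_apply,
      hm (g x) ⟨hg.1.monotone hx.1, hg.1.monotone hx.2⟩, hn x hx, zpow_add₀ (by norm_num)]
    ring

/-- R. Thompson's group `F`. -/
def thompsonF : Subgroup (unitInterval ≃ₜ unitInterval) where
  carrier := {f | IsThompson f}
  one_mem' := IsThompson.one
  mul_mem' := IsThompson.mul
  inv_mem' := IsThompson.inv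

/-! ### Binary words and binary trees -/

/-- Finite binary words, which are the vertices of the rooted planar binary tree
(`0` is a left edge, `1` is a right edge). -/
abbrev Word := List (Fin 2)

/-- Infinite binary words. -/
abbrev InfWord := Stream' (Fin 2)

/-- A (finite or infinite) rooted binary tree in which every vertex has either no child or both a
left and a right child. A vertex is identified with the label of the path from the root to it. -/
structure BinTree where
  /-- the set of vertices -/
  verts : Set Word
  root_mem : [] ∈ verts
  parent_mem : ∀ (w : Word) (a : Fin 2), w ++ [a] ∈ verts → w ∈ verts
  sibling_mem : ∀ (w : Word) (a b : Fin 2), w ++ [a] ∈ verts → w ++ [b] ∈ verts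

namespace BinTree

/-- The finite branches of a tree are (the labels of) its leaves. -/
def IsFinBranch (T : BinTree) (u : Word) : Prop :=
  u ∈ T.verts ∧ ∀ a : Fin 2, u ++ [a] ∉ T.verts

/-- An infinite word is an infinite branch of a tree if all its prefixes are vertices. -/
def IsInfBranch (T : BinTree) (ω : InfWord) : Prop :=
  ∀ n : ℕ, ω.take n ∈ T.verts

/-- The finite branches. -/
abbrev FinBranch (T : BinTree) := {u : Word // T.IsFinBranch u}

/-- The infinite branches. -/
abbrev InfBranch (T : BinTree) := {ω : InfWord // T.IsInfBranch ω}

/-- The branches (maximal simple paths from the root), finite or infinite. -/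
abbrev Branch (T : BinTree) := T.FinBranch ⊕ T.InfBranch

/-- The word `w` is a prefix of the label of the branch. -/
def HasPrefix {T : BinTree} (w : Word) : T.Branch → Prop
  | Sum.inl u => w <+: u.1
  | Sum.inr ω => ∃ α : InfWord, ω.1 = w ++ₛ α

/-- The left-to-right order on the branches of a tree: at the vertex `w` where they separate, `p`
goes to the left and `q` goes to the right. -/
def LeftOf {T : BinTree} (p q : T.Branch) : Prop :=
  ∃ w : Word, HasPrefix (w ++ [0]) p ∧ HasPrefix (w ++ [1]) q

/-- The infinite words which start with the branch: `u α` with `α` arbitrary for a finite branch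
`u`, and the branch itself (whatever `α` is) for an infinite branch. -/
def point {T : BinTree} (p : T.Branch) (α : InfWord) : InfWord :=
  match p with
  | Sum.inl u => u.1 ++ₛ α
  | Sum.inr ω => ω.1

end BinTree

/-- A tree-diagram: a triple `(T₊, T₋, φ)` where `T₊`, `T₋` are possibly infinite binary trees with
the same finite number of infinite branches and `φ` is a bijection from the branches of `T₊` to the
branches of `T₋` which preserves the left-to-right order and takes infinite branches to infinite
branches. -/
structure TreeDiagram where
  /-- the tree `T₊` -/
  source : BinTree
  /-- the tree `T₋` -/
  target : BinTree
  /-- the bijection of branches -/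
  φ : source.Branch ≃ target.Branch
  finite_source : Finite source.InfBranch
  finite_target : Finite target.InfBranch
  card_eq : Nat.card source.InfBranch = Nat.card target.InfBranch
  map_leftOf : ∀ p q : source.Branch, BinTree.LeftOf p q → BinTree.LeftOf (φ p) (φ q)
  map_inf : ∀ ω : source.InfBranch, ∃ ω' : target.InfBranch, φ (Sum.inr ω) = Sum.inr ω'

/-- The point `.ξ` of `[0,1]` with binary expansion `ξ`. -/
noncomputable def val (ξ : InfWord) : unitInterval :=
  ⟨Real.ofDigits (b := 2) ξ, Real.ofDigits_nonneg _, Real.ofDigits_le_one _⟩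

/-- The homeomorphism `h` of `[0,1]` is the one that corresponds to the tree-diagram `D`: it takes
`.uα` to `.φ(u)α` for every finite branch `u` of `T₊` and every infinite word `α` (that is, `h` maps
the dyadic interval `[u]` linearly onto the dyadic interval `[φ(u)]`), and it takes `.ω` to `.φ(ω)`
for every infinite branch `ω` of `T₊`. -/
def TreeDiagram.Represents (D : TreeDiagram) (h : unitInterval ≃ₜ unitInterval) : Prop :=
  ∀ (p : D.source.Branch) (α : InfWord),
    h (val (BinTree.point p α)) = val (BinTree.point (D.φ p) α)

/-! ### The homeomorphisms given by tree-diagrams form a group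

A tree-diagram acts on the infinite binary words. The permutations that arise are those which are
strictly increasing for the lexicographic order and which, away from finitely many words, replace a
finite prefix by another one. -/

section Aux

theorem append_eq_append_cases {u v : Word} {α β : InfWord} (h : u ++ₛ α = v ++ₛ β) :
    (∃ s, v = u ++ s ∧ α = s ++ₛ β) ∨ (∃ s, u = v ++ s ∧ β = s ++ₛ α) := by
  induction u generalizing v with
  | nil => exact Or.inl ⟨v, by simp, by simpa using h⟩
  | cons a u ih =>
    cases v with
    | nil => exact Or.inr ⟨a :: u, by simp, by simpa using h.symm⟩
    | cons b v =>
      rw [Stream'.cons_append_stream, Stream'.cons_append_stream] at h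
      have h1 : a = b := by simpa using congrArg Stream'.head h
      have h2 : u ++ₛ α = v ++ₛ β := by simpa using congrArg Stream'.tail h
      subst h1
      rcases ih h2 with ⟨s, hs, hs'⟩ | ⟨s, hs, hs'⟩
      · exact Or.inl ⟨s, by simp [hs], hs'⟩
      · exact Or.inr ⟨s, by simp [hs], hs'⟩

theorem take_length_append (u : Word) (α : InfWord) : (u ++ₛ α).take u.length = u := by
  have := Stream'.append_take (x := u) (a := α) (n := 0)
  simpa using this.symm

/-- The lexicographic order on infinite words. -/
def WordLT (ξ η : InfWord) : Prop :=
  ∃ (w : Word) (α β : InfWord), ξ = (w ++ [0]) ++ₛ α ∧ η = (w ++ [1]) ++ₛ β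

theorem wordLT_iff {ξ η : InfWord} :
    WordLT ξ η ↔ ∃ n, ξ.take n = η.take n ∧ ξ.get n = 0 ∧ η.get n = 1 := by
  constructor
  · rintro ⟨w, α, β, rfl, rfl⟩
    refine ⟨w.length, ?_, ?_, ?_⟩
    · rw [Stream'.append_append_stream, Stream'.append_append_stream, take_length_append,
        take_length_append]
    · simp [Stream'.append_append_stream]
    · simp [Stream'.append_append_stream]
  · rintro ⟨n, h, h0, h1⟩
    refine ⟨ξ.take n, ξ.drop (n + 1), η.drop (n + 1), ?_, ?_⟩
    · rw [← h0, Stream'.concat_take_get, Stream'.append_take_drop]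
    · rw [h, ← h1, Stream'.concat_take_get, Stream'.append_take_drop]

theorem get_eq_of_take_eq {ξ η : InfWord} {n m : ℕ} (h : ξ.take n = η.take n) (hm : m < n) :
    ξ.get m = η.get m := by
  have h1 := Stream'.getElem?_take (s := ξ) hm
  have h2 := Stream'.getElem?_take (s := η) hm
  rw [h, h2] at h1
  exact (Option.some.inj h1).symm

theorem WordLT.asymm {ξ η : InfWord} (h : WordLT ξ η) (h' : WordLT η ξ) : False := by
  rw [wordLT_iff] at h h'
  obtain ⟨n, e, h0, h1⟩ := h
  obtain ⟨m, e', h0', h1'⟩ := h'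
  rcases lt_trichotomy n m with hnm | rfl | hnm
  · have := get_eq_of_take_eq e' hnm
    rw [h0, h1] at this
    exact absurd this (by decide)
  · rw [h0] at h1'
    exact absurd h1' (by decide)
  · have := get_eq_of_take_eq e hnm
    rw [h0', h1'] at this
    exact absurd this (by decide)

theorem WordLT.or_of_ne {ξ η : InfWord} (h : ξ ≠ η) : WordLT ξ η ∨ WordLT η ξ := by
  classical
  have hex : ∃ n, ξ.take n ≠ η.take n := by
    by_contra hc
    push Not at hc
    exact h (Stream'.take_theorem _ _ hc)
  have hs := Nat.find_spec hex
  have hm := fun m => Nat.find_min hex (m := m)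
  generalize Nat.find hex = k at hs hm
  cases k with
  | zero => simp at hs
  | succ n =>
    have e : ξ.take n = η.take n := by
      by_contra hc
      exact hm n (Nat.lt_succ_self n) hc
    have hne : ξ.get n ≠ η.get n := by
      intro hc
      apply hs
      rw [Stream'.take_succ', Stream'.take_succ', e, hc]
    rw [wordLT_iff, wordLT_iff]
    generalize ha : ξ.get n = a at hne
    generalize hb : η.get n = b at hne
    have : (a = 0 ∧ b = 1) ∨ (b = 0 ∧ a = 1) := by
      clear ha hb
      revert a b; decide
    rcases this with ⟨rfl, rfl⟩ | ⟨rfl, rfl⟩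
    · exact Or.inl ⟨n, e, ha, hb⟩
    · exact Or.inr ⟨n, e.symm, hb, ha⟩

theorem WordLT.append {u : Word} {α β : InfWord} (h : WordLT α β) :
    WordLT (u ++ₛ α) (u ++ₛ β) := by
  obtain ⟨w, γ, δ, rfl, rfl⟩ := h
  exact ⟨u ++ w, γ, δ, by simp [Stream'.append_append_stream],
    by simp [Stream'.append_append_stream]⟩

theorem WordLT.irrefl {ξ : InfWord} (h : WordLT ξ ξ) : False := h.asymm h

theorem WordLT.of_append {u : Word} {α β : InfWord} (h : WordLT (u ++ₛ α) (u ++ₛ β)) :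
    WordLT α β := by
  have hne : α ≠ β := by
    rintro rfl
    exact h.irrefl
  rcases WordLT.or_of_ne hne with h' | h'
  · exact h'
  · exact (h.asymm h'.append).elim

namespace BinTree

variable {T : BinTree}

theorem prefix_mem {u s : Word} (h : u ++ s ∈ T.verts) : u ∈ T.verts := by
  induction s using List.reverseRecOn with
  | nil => simpa using h
  | append_singleton s a ih =>
    rw [← List.append_assoc] at h
    exact ih (T.parent_mem _ _ h)

theorem leaf_append {u s : Word} (hu : T.IsFinBranch u) (h : u ++ s ∈ T.verts) : s = [] := by
  cases s with
  | nil => rfl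
  | cons a s =>
    have : (u ++ [a]) ++ s ∈ T.verts := by simpa using h
    exact (hu.2 a (prefix_mem this)).elim

theorem mem_of_inf {ω : InfWord} (hω : T.IsInfBranch ω) {u : Word} {α : InfWord}
    (h : ω = u ++ₛ α) : u ∈ T.verts := by
  have := hω u.length
  rwa [h, take_length_append] at this

theorem leaf_not_inf {ω : InfWord} (hω : T.IsInfBranch ω) {u : Word} (hu : T.IsFinBranch u)
    {α : InfWord} (h : ω = u ++ₛ α) : False := by
  apply hu.2 α.head
  apply mem_of_inf hω (α := α.tail)
  rw [Stream'.append_append_stream, Stream'.append_stream_head_tail, h]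

theorem eq_of_point_eq {p q : T.Branch} {α β : InfWord} (h : point p α = point q β) : p = q := by
  rcases p with ⟨u, hu⟩ | ⟨ω, hω⟩ <;> rcases q with ⟨v, hv⟩ | ⟨η, hη⟩
  · simp only [point] at h
    rcases append_eq_append_cases h with ⟨s, rfl, -⟩ | ⟨s, rfl, -⟩
    · have := leaf_append hu hv.1
      subst this
      simp
    · have := leaf_append hv hu.1
      subst this
      simp
  · exact (leaf_not_inf hη hu h.symm).elim
  · exact (leaf_not_inf hω hv h).elim
  · simp only [point] at h
    subst h
    rfl

theorem exists_point (T : BinTree) (ξ : InfWord) : ∃ (p : T.Branch) (α : InfWord), ξ = point p α := by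
  classical
  by_cases h : T.IsInfBranch ξ
  · exact ⟨Sum.inr ⟨ξ, h⟩, ξ, rfl⟩
  · have hex : ∃ n, ξ.take n ∉ T.verts := by
      simpa [IsInfBranch] using h
    have hs := Nat.find_spec hex
    have hm := fun m => Nat.find_min hex (m := m)
    generalize Nat.find hex = k at hs hm
    cases k with
    | zero => exact (hs (by simpa using T.root_mem)).elim
    | succ n =>
      have h1 : ξ.take n ∈ T.verts := by
        by_contra hc
        exact hm n (Nat.lt_succ_self n) hc
      refine ⟨Sum.inl ⟨ξ.take n, h1, fun a ha => hs ?_⟩, ξ.drop n, ?_⟩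
      · rw [Stream'.take_succ']
        exact T.sibling_mem _ _ _ ha
      · simp [point]

theorem LeftOf.wordLT {p q : T.Branch} (h : LeftOf p q) (α β : InfWord) :
    WordLT (point p α) (point q β) := by
  have key : ∀ (p : T.Branch) (w : Word) (α : InfWord), HasPrefix w p →
      ∃ γ, point p α = w ++ₛ γ := by
    rintro (⟨u, hu⟩ | ⟨ω, hω⟩) w α hw
    · obtain ⟨s, hs⟩ := hw
      exact ⟨s ++ₛ α, by simp only at hs; simp [point, ← hs, Stream'.append_append_stream]⟩
    · exact hw
  obtain ⟨w, h0, h1⟩ := h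
  obtain ⟨γ, hγ⟩ := key p _ α h0
  obtain ⟨δ, hδ⟩ := key q _ β h1
  exact ⟨w, γ, δ, hγ, hδ⟩

theorem leftOf_of_wordLT {p q : T.Branch} (hne : p ≠ q) {α β : InfWord}
    (h : WordLT (point p α) (point q β)) : LeftOf p q := by
  obtain ⟨w, γ, δ, h0, h1⟩ := h
  have key : ∀ (p q : T.Branch) (hne : p ≠ q) (a b : Fin 2) (α β γ δ : InfWord),
      point p α = (w ++ [a]) ++ₛ γ → point q β = (w ++ [b]) ++ₛ δ → HasPrefix (w ++ [a]) p := by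
    rintro (⟨u, hu⟩ | ⟨ω, hω⟩) q hne a b α β γ δ hp hq
    · simp only [point] at hp
      rcases append_eq_append_cases hp with ⟨s, hs, -⟩ | ⟨s, hs, -⟩
      · rcases List.eq_nil_or_concat s with rfl | ⟨s', c, rfl⟩
        · exact ⟨[], by simpa using hs⟩
        · exfalso
          rw [List.concat_eq_append, ← List.append_assoc] at hs
          have hw : w = u ++ s' := (List.append_inj' hs rfl).1
          apply hne
          apply eq_of_point_eq (α := (s' ++ [b]) ++ₛ δ) (β := β)
          rw [hq, hw]
          simp [point, Stream'.append_append_stream]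
      · exact ⟨s, hs.symm⟩
    · exact ⟨γ, hp⟩
  exact ⟨w, key p q hne 0 1 α β γ δ h0 h1, key q p hne.symm 1 0 β α δ γ h1 h0⟩

end BinTree

open BinTree

/-- `H` replaces the prefix `u` by the prefix `v`. -/
def Replaces (H : InfWord → InfWord) (u v : Word) : Prop := ∀ α, H (u ++ₛ α) = v ++ₛ α

/-- `H` has a regular point at `ξ`: it replaces some prefix of `ξ` by another word. -/
def RegularAt (H : InfWord → InfWord) (ξ : InfWord) : Prop :=
  ∃ u v α, ξ = u ++ₛ α ∧ Replaces H u v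

/-- The conditions on a permutation of the infinite words to come from a tree-diagram. -/
structure IsTreeLike (H : Equiv.Perm InfWord) : Prop where
  mono : ∀ ξ η, WordLT ξ η → WordLT (H ξ) (H η)
  finite : {ξ | ¬ RegularAt H ξ}.Finite

theorem IsTreeLike.one : IsTreeLike 1 where
  mono := fun _ _ h => h
  finite := by
    convert Set.finite_empty
    ext ξ
    simp only [Set.mem_ofPred_eq, Set.mem_empty_iff_false, iff_false, not_not]
    exact ⟨[], [], ξ, rfl, fun _ => rfl⟩

theorem IsTreeLike.mul {H K : Equiv.Perm InfWord} (hH : IsTreeLike H) (hK : IsTreeLike K) :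
    IsTreeLike (H * K) where
  mono := fun _ _ h => hH.mono _ _ (hK.mono _ _ h)
  finite := by
    refine (hK.finite.union (hH.finite.preimage K.injective.injOn)).subset ?_
    intro ξ hξ
    by_contra hc
    simp only [Set.mem_union, Set.mem_preimage, Set.mem_ofPred_eq, not_or, not_not] at hc
    obtain ⟨⟨u, v, α, rfl, huv⟩, u', v', α', hα', huv'⟩ := hc
    rw [huv α] at hα'
    apply hξ
    rcases append_eq_append_cases hα' with ⟨s, hs, rfl⟩ | ⟨s, hs, hs'⟩
    · refine ⟨u ++ s, v', α', by simp [Stream'.append_append_stream], fun β => ?_⟩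
      rw [Equiv.Perm.mul_apply, Stream'.append_append_stream, huv, ← Stream'.append_append_stream,
        ← hs, huv']
    · refine ⟨u, v' ++ s, α, rfl, fun β => ?_⟩
      rw [Equiv.Perm.mul_apply, huv, hs, Stream'.append_append_stream, huv',
        Stream'.append_append_stream]

theorem Replaces.symm {H : Equiv.Perm InfWord} {u v : Word} (h : Replaces H u v) :
    Replaces (H⁻¹ : Equiv.Perm InfWord) v u := by
  intro α
  rw [← h α]
  exact H.symm_apply_apply _

theorem IsTreeLike.inv {H : Equiv.Perm InfWord} (hH : IsTreeLike H) : IsTreeLike H⁻¹ where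
  mono := fun ξ η h => by
    have hne : H⁻¹ ξ ≠ H⁻¹ η := by
      intro hc
      rw [(H⁻¹ : Equiv.Perm InfWord).injective hc] at h
      exact h.irrefl
    rcases WordLT.or_of_ne hne with h' | h'
    · exact h'
    · have := hH.mono _ _ h'
      rw [show H (H⁻¹ ξ) = ξ from H.apply_symm_apply ξ,
        show H (H⁻¹ η) = η from H.apply_symm_apply η] at this
      exact (h.asymm this).elim
  finite := by
    refine (hH.finite.image H).subset ?_
    intro ξ hξ
    refine ⟨H⁻¹ ξ, ?_, by simp⟩
    rintro ⟨u, v, α, hα, huv⟩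
    apply hξ
    refine ⟨v, u, α, ?_, huv.symm⟩
    rw [← huv α, ← hα]
    simp

namespace TreeDiagram

theorem map_fin (D : TreeDiagram) (u : D.source.FinBranch) :
    ∃ v : D.target.FinBranch, D.φ (Sum.inl u) = Sum.inl v := by
  classical
  have := D.finite_source
  have := D.finite_target
  choose f hf using D.map_inf
  have hinj : Function.Injective f := by
    intro a b hab
    have : D.φ (Sum.inr a) = D.φ (Sum.inr b) := by rw [hf, hf, hab]
    simpa using D.φ.injective this
  have hsurj : Function.Surjective f :=
    ((Nat.bijective_iff_injective_and_card f).2 ⟨hinj, D.card_eq⟩).2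
  rcases hv : D.φ (Sum.inl u) with v | ω
  · exact ⟨v, rfl⟩
  · obtain ⟨a, rfl⟩ := hsurj ω
    rw [← hf] at hv
    exact absurd (D.φ.injective hv) (by simp)

/-- The action of a tree-diagram on the infinite words. -/
theorem exists_perm (D : TreeDiagram) : ∃ H : Equiv.Perm InfWord, IsTreeLike H ∧
    ∀ (p : D.source.Branch) (α : InfWord), H (point p α) = point (D.φ p) α := by
  choose br tl hbt using D.source.exists_point
  choose br' tl' hbt' using D.target.exists_point
  have key : ∀ p α, point (D.φ (br (point p α))) (tl (point p α)) = point (D.φ p) α := by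
    intro p α
    have h := hbt (point p α)
    have hp := eq_of_point_eq h
    rw [← hp] at h ⊢
    rcases p with u | ω
    · simp only [point, Stream'.append_right_inj] at h ⊢
      exact congrArg (point (D.φ (Sum.inl u))) h.symm
    · obtain ⟨ω', hω'⟩ := D.map_inf ω
      simp only [hω', point]
  have key' : ∀ q α, point (D.φ.symm (br' (point q α))) (tl' (point q α)) =
      point (D.φ.symm q) α := by
    intro q α
    have h := hbt' (point q α)
    have hq := eq_of_point_eq h
    rw [← hq] at h ⊢
    rcases q with u | ω
    · simp only [point, Stream'.append_right_inj] at h ⊢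
      exact congrArg (point (D.φ.symm (Sum.inl u))) h.symm
    · rcases hp : D.φ.symm (Sum.inr ω) with u | ω'
      · obtain ⟨v, hv⟩ := D.map_fin u
        rw [← hp, Equiv.apply_symm_apply] at hv
        exact absurd hv (by simp)
      · simp only [point]
  let H : Equiv.Perm InfWord :=
    { toFun := fun ξ => point (D.φ (br ξ)) (tl ξ)
      invFun := fun ξ => point (D.φ.symm (br' ξ)) (tl' ξ)
      left_inv := fun ξ => by
        simp only [key', Equiv.symm_apply_apply, ← hbt]
      right_inv := fun ξ => by
        simp only [key, Equiv.apply_symm_apply, ← hbt'] }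
  have hH : ∀ p α, H (point p α) = point (D.φ p) α := key
  refine ⟨H, ⟨?_, ?_⟩, hH⟩
  · intro ξ η h
    obtain ⟨p, α, rfl⟩ := D.source.exists_point ξ
    obtain ⟨q, β, rfl⟩ := D.source.exists_point η
    rw [hH, hH]
    by_cases hpq : p = q
    · subst hpq
      rcases p with u | ω
      · obtain ⟨v, hv⟩ := D.map_fin u
        rw [hv]
        exact (WordLT.of_append h).append
      · exact h.irrefl.elim
    · exact (D.map_leftOf _ _ (leftOf_of_wordLT hpq h)).wordLT _ _
  · have := D.finite_source
    refine (Set.finite_range (fun ω : D.source.InfBranch => ω.1)).subset ?_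
    intro ξ hξ
    obtain ⟨p, α, rfl⟩ := D.source.exists_point ξ
    rcases p with u | ω
    · obtain ⟨v, hv⟩ := D.map_fin u
      refine (hξ ⟨u.1, v.1, α, rfl, fun β => ?_⟩).elim
      have := hH (Sum.inl u) β
      rw [hv] at this
      exact this
    · exact ⟨ω, rfl⟩

end TreeDiagram

/-- The tree of the words without a proper prefix that `H` replaces by another word. -/
def regTree (H : InfWord → InfWord) : BinTree where
  verts := {w | ∀ u s v, w = u ++ s → s ≠ [] → ¬ Replaces H u v}
  root_mem := by
    intro u s v h hs
    simp_all
  parent_mem := by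
    intro w a h u s v hw hs
    exact h u (s ++ [a]) v (by simp [hw]) (by simp)
  sibling_mem := by
    intro w a b h u s v hw hs
    rcases List.eq_nil_or_concat s with rfl | ⟨s', c, rfl⟩
    · exact (hs rfl).elim
    · rw [List.concat_eq_append, ← List.append_assoc] at hw
      have hw' : w = u ++ s' := (List.append_inj' hw rfl).1
      exact h u (s' ++ [a]) v (by simp [hw']) (by simp)

theorem regTree_fin {H : InfWord → InfWord} {u : Word} :
    (regTree H).IsFinBranch u ↔ u ∈ (regTree H).verts ∧ ∃ v, Replaces H u v := by
  constructor
  · rintro ⟨h, h'⟩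
    refine ⟨h, ?_⟩
    by_contra hc
    push Not at hc
    apply h' 0
    intro u' s v hu hs
    rcases List.eq_nil_or_concat s with rfl | ⟨s', c, rfl⟩
    · exact (hs rfl).elim
    · rw [List.concat_eq_append, ← List.append_assoc] at hu
      have hu' : u = u' ++ s' := (List.append_inj' hu rfl).1
      by_cases hs' : s' = []
      · subst hs'
        simp only [List.append_nil] at hu'
        exact hu' ▸ hc v
      · exact h u' s' v hu' hs'
  · rintro ⟨h, v, hv⟩
    exact ⟨h, fun a ha => ha u [a] v rfl (by simp) hv⟩

theorem regTree_inf {H : InfWord → InfWord} {ω : InfWord} :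
    (regTree H).IsInfBranch ω ↔ ¬ RegularAt H ω := by
  constructor
  · rintro h ⟨u, v, α, rfl, huv⟩
    have h1 : u ++ [α.head] ∈ (regTree H).verts := by
      apply mem_of_inf h (α := α.tail)
      rw [Stream'.append_append_stream, Stream'.append_stream_head_tail]
    exact h1 u [α.head] v rfl (by simp) huv
  · intro h n u s v hu _ huv
    apply h
    refine ⟨u, v, s ++ₛ ω.drop n, ?_, huv⟩
    rw [← Stream'.append_append_stream, ← hu, Stream'.append_take_drop]

theorem eq_append_of_forall {u w : Word} (h : ∀ α : InfWord, u ++ₛ α = w ++ₛ α) : u = w := by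
  have key : ∀ (s : Word), (∀ α : InfWord, α = s ++ₛ α) → s = [] := by
    intro s hs
    cases s with
    | nil => rfl
    | cons a s =>
      exfalso
      have h0 := congrArg Stream'.head (hs (Stream'.const (a + 1)))
      rw [Stream'.cons_append_stream, Stream'.head_cons] at h0
      have h1 : a + 1 = a := h0
      clear hs h0
      revert a
      decide
  have h0 := h (Stream'.const 0)
  have hcase : (∃ s, w = u ++ s) ∨ (∃ s, u = w ++ s) := by
    rcases append_eq_append_cases h0 with ⟨s, hs, -⟩ | ⟨s, hs, -⟩
    · exact Or.inl ⟨s, hs⟩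
    · exact Or.inr ⟨s, hs⟩
  rcases hcase with ⟨s, rfl⟩ | ⟨s, rfl⟩
  · have : s = [] := key s fun α => by
      have := h α
      rw [Stream'.append_append_stream] at this
      exact Stream'.append_right_injective _ _ _ this
    simp [this]
  · have : s = [] := key s fun α => by
      have := h α
      rw [Stream'.append_append_stream] at this
      exact (Stream'.append_right_injective _ _ _ this).symm
    simp [this]

theorem exists_regTree_branch {H K : InfWord → InfWord} (hKH : ∀ ξ, K (H ξ) = ξ)
    (hHK : ∀ ξ, H (K ξ) = ξ) (p : (regTree H).Branch) :
    ∃ q : (regTree K).Branch, ∀ α, point q α = H (point p α) := by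
  have hsymm : ∀ {u v}, Replaces K v u → Replaces H u v := by
    intro u v h α
    rw [← h α, hHK]
  have hsymm' : ∀ {u v}, Replaces H u v → Replaces K v u := by
    intro u v h α
    rw [← h α, hKH]
  rcases p with ⟨u, hu⟩ | ⟨ω, hω⟩
  · obtain ⟨hmem, v, huv⟩ := regTree_fin.1 hu
    refine ⟨Sum.inl ⟨v, regTree_fin.2 ⟨?_, u, hsymm' huv⟩⟩, fun α => (huv α).symm⟩
    intro v' s u' hv hs hvu
    refine hmem u' s v' ?_ hs (hsymm hvu)
    apply eq_append_of_forall
    intro α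
    rw [← hsymm' huv α, hv, Stream'.append_append_stream, hvu, Stream'.append_append_stream]
  · refine ⟨Sum.inr ⟨H ω, regTree_inf.2 ?_⟩, fun α => rfl⟩
    rintro ⟨v, u, α, hα, huv⟩
    refine regTree_inf.1 hω ⟨u, v, α, ?_, hsymm huv⟩
    rw [← huv α, ← hα, hKH]

theorem IsTreeLike.exists_diagram {H : Equiv.Perm InfWord} (hH : IsTreeLike H) :
    ∃ D : TreeDiagram, ∀ (p : D.source.Branch) (α : InfWord),
      point (D.φ p) α = H (point p α) := by
  set K : Equiv.Perm InfWord := H⁻¹ with hK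
  have hKH : ∀ ξ, K (H ξ) = ξ := fun ξ => by simp [hK]
  have hHK : ∀ ξ, H (K ξ) = ξ := fun ξ => by simp [hK]
  have hKt : IsTreeLike K := hH.inv
  choose f hf using exists_regTree_branch hKH hHK
  choose g hg using exists_regTree_branch hHK hKH
  have hfinH : Finite (regTree H).InfBranch :=
    (hH.finite.subset fun ω hω => regTree_inf.1 hω).to_subtype
  have hfinK : Finite (regTree K).InfBranch :=
    (hKt.finite.subset fun ω hω => regTree_inf.1 hω).to_subtype
  have hinf : ∀ {A B : Equiv.Perm InfWord} (hBA : ∀ ξ, B (A ξ) = ξ) (hAB : ∀ ξ, A (B ξ) = ξ)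
      (ω : InfWord), (regTree A).IsInfBranch ω → (regTree B).IsInfBranch (A ω) := by
    intro A B hBA hAB ω hω
    rw [regTree_inf] at hω ⊢
    rintro ⟨v, u, α, hα, huv⟩
    refine hω ⟨u, v, α, ?_, fun β => ?_⟩
    · rw [← huv α, ← hα, hBA]
    · rw [← huv β, hAB]
  refine ⟨{ source := regTree H, target := regTree K, φ := ⟨f, g, fun p => ?_, fun q => ?_⟩,
            finite_source := hfinH, finite_target := hfinK, card_eq := ?_, map_leftOf := ?_,
            map_inf := ?_ }, fun p α => hf p α⟩
  · apply eq_of_point_eq (α := Stream'.const 0) (β := Stream'.const 0)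
    rw [hg, hf, hKH]
  · apply eq_of_point_eq (α := Stream'.const 0) (β := Stream'.const 0)
    rw [hf, hg, hHK]
  · refine Nat.card_congr ⟨fun ω => ⟨H ω.1, hinf hKH hHK _ ω.2⟩,
      fun ω => ⟨K ω.1, hinf hHK hKH _ ω.2⟩, fun ω => Subtype.ext (hKH _),
      fun ω => Subtype.ext (hHK _)⟩
  · intro p q hpq
    have h1 := hpq.wordLT (Stream'.const 0) (Stream'.const 0)
    have h2 := hH.mono _ _ h1
    have hne : f p ≠ f q := by
      intro hc
      rw [← hf, ← hf, hc] at h2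
      exact h2.irrefl
    rw [← hf, ← hf] at h2
    exact leftOf_of_wordLT hne h2
  · intro ω
    refine ⟨⟨H ω.1, hinf hKH hHK _ ω.2⟩, ?_⟩
    apply eq_of_point_eq (α := Stream'.const 0) (β := Stream'.const 0)
    exact hf (Sum.inr ω) (Stream'.const 0)

theorem exists_represents_iff {h : unitInterval ≃ₜ unitInterval} :
    (∃ D : TreeDiagram, D.Represents h) ↔
      ∃ H : Equiv.Perm InfWord, IsTreeLike H ∧ ∀ ξ, h (val ξ) = val (H ξ) := by
  constructor
  · rintro ⟨D, hD⟩
    obtain ⟨H, hH, hHD⟩ := D.exists_perm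
    refine ⟨H, hH, fun ξ => ?_⟩
    obtain ⟨p, α, rfl⟩ := D.source.exists_point ξ
    rw [hD, hHD]
  · rintro ⟨H, hH, hh⟩
    obtain ⟨D, hD⟩ := hH.exists_diagram
    exact ⟨D, fun p α => by rw [hh, hD]⟩

end Aux

/-- The group `𝓕` of tree-diagrams with finitely many infinite branches, identified with its image
in `Homeo([0,1])`: it consists of the homeomorphisms that correspond to tree-diagrams. -/
def treeGroup : Subgroup (unitInterval ≃ₜ unitInterval) where
  carrier := {h | ∃ D : TreeDiagram, D.Represents h}
  one_mem' := exists_represents_iff.2 ⟨1, IsTreeLike.one, fun _ => rfl⟩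
  mul_mem' := by
    intro a b ha hb
    obtain ⟨H, hH, h1⟩ := exists_represents_iff.1 ha
    obtain ⟨K, hK, h2⟩ := exists_represents_iff.1 hb
    exact exists_represents_iff.2 ⟨H * K, hH.mul hK, fun ξ => by
      rw [Homeomorph.mul_apply, h2, h1, Equiv.Perm.mul_apply]⟩
  inv_mem' := by
    intro a ha
    obtain ⟨H, hH, h1⟩ := exists_represents_iff.1 ha
    refine exists_represents_iff.2 ⟨H⁻¹, hH.inv, fun ξ => ?_⟩
    have : a (val (H⁻¹ ξ)) = val ξ := by rw [h1]; simp
    rw [← this]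
    exact a.symm_apply_apply _

/-! ### The Hamming metric and the completion -/

/-- The Lebesgue measure of the set of points where two self-maps of `[0,1]` differ. -/
noncomputable def diffMeasure (f g : unitInterval → unitInterval) : ℝ :=
  MeasureTheory.volume.real {x | f x ≠ g x}

/-- The Hamming metric on `F`:
`dist_H(f, g) = μ {x | f x ≠ g x} + μ {x | f⁻¹ x ≠ g⁻¹ x}`. -/
noncomputable def hammingDist (f g : thompsonF) : ℝ :=
  diffMeasure f.1 g.1 + diffMeasure (f⁻¹).1 (g⁻¹).1

/-- A sequence in `F` is Cauchy for the Hamming metric. -/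
def IsHammingCauchy (f : ℕ → thompsonF) : Prop :=
  ∀ ε > 0, ∃ N, ∀ m ≥ N, ∀ n ≥ N, hammingDist (f m) (f n) < ε

section Aux

open MeasureTheory

theorem diffMeasure_nonneg (f g : unitInterval → unitInterval) : 0 ≤ diffMeasure f g :=
  measureReal_nonneg

theorem diffMeasure_self (f : unitInterval → unitInterval) : diffMeasure f f = 0 := by
  simp [diffMeasure]

theorem diffMeasure_comm (f g : unitInterval → unitInterval) :
    diffMeasure f g = diffMeasure g f := by
  simp only [diffMeasure, ne_comm]

theorem diffMeasure_triangle (f g h : unitInterval → unitInterval) :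
    diffMeasure f h ≤ diffMeasure f g + diffMeasure g h := by
  refine (measureReal_mono ?_).trans (measureReal_union_le _ _)
  intro x hx
  by_contra hc
  simp only [Set.mem_union, Set.mem_ofPred_eq, not_or, not_not] at hc
  exact hx (hc.1.trans hc.2)

theorem hammingDist_nonneg (f g : thompsonF) : 0 ≤ hammingDist f g :=
  add_nonneg (diffMeasure_nonneg _ _) (diffMeasure_nonneg _ _)

theorem hammingDist_inv (f g : thompsonF) : hammingDist f⁻¹ g⁻¹ = hammingDist f g := by
  simp only [hammingDist, inv_inv]
  ring

theorem hammingDist_comm (f g : thompsonF) : hammingDist f g = hammingDist g f := by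
  simp only [hammingDist]
  rw [diffMeasure_comm, diffMeasure_comm (f⁻¹).1]

theorem hammingDist_triangle (f g h : thompsonF) :
    hammingDist f h ≤ hammingDist f g + hammingDist g h := by
  have h1 := diffMeasure_triangle f.1 g.1 h.1
  have h2 := diffMeasure_triangle (f⁻¹).1 (g⁻¹).1 (h⁻¹).1
  simp only [hammingDist]
  linarith

theorem IsThompson.exists_lipschitz {f : unitInterval ≃ₜ unitInterval} (hf : IsThompson f) :
    ∃ K : NNReal, LipschitzWith K f := by
  obtain ⟨S, hS, hlin⟩ := hf.2
  have key : ∀ z : unitInterval, ∃ C : ℝ, 0 ≤ C ∧ ∀ x y, x ≤ y → y ≤ z →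
      (f y : ℝ) - f x ≤ C * ((y : ℝ) - x) := by
    intro z
    refine induction_breaks S (fun z => ∃ C : ℝ, 0 ≤ C ∧ ∀ x y, x ≤ y → y ≤ z →
      (f y : ℝ) - f x ≤ C * ((y : ℝ) - x)) ?_ ?_ z
    · refine ⟨0, le_rfl, fun x y hxy hy => ?_⟩
      have : x = y := le_antisymm hxy (hy.trans unitInterval.nonneg')
      simp [this]
    · rintro t z htz - hI ⟨C, hC0, hC⟩
      obtain ⟨n, hn⟩ := hlin t z htz hI
      have h2 : (0 : ℝ) < 2 ^ n := by positivity
      refine ⟨max C (2 ^ n), le_max_of_le_left hC0, fun x y hxy hy => ?_⟩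
      have hxy' : (x : ℝ) ≤ y := hxy
      have m1 := le_max_left C ((2 : ℝ) ^ n)
      have m2 := le_max_right C ((2 : ℝ) ^ n)
      rcases le_total y t with hyt | hyt
      · exact (hC x y hxy hyt).trans (mul_le_mul_of_nonneg_right m1 (by linarith))
      · have hyt' : (t : ℝ) ≤ y := hyt
        rw [hn y ⟨hyt, hy⟩]
        rcases le_total x t with hxt | hxt
        · have hxt' : (x : ℝ) ≤ t := hxt
          have a1 := hC x t hxt le_rfl
          have a2 := mul_le_mul_of_nonneg_right m1 (sub_nonneg.2 hxt')
          have a3 := mul_le_mul_of_nonneg_right m2 (sub_nonneg.2 hyt')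
          nlinarith
        · rw [hn x ⟨hxt, hxy.trans hy⟩]
          have a3 := mul_le_mul_of_nonneg_right m2 (sub_nonneg.2 hxy')
          nlinarith
  obtain ⟨C, hC0, hC⟩ := key 1
  refine ⟨⟨C, hC0⟩, LipschitzWith.of_dist_le_mul fun x y => ?_⟩
  have hmain : ∀ x y : unitInterval, x ≤ y → dist (f x) (f y) ≤ C * dist x y := by
    intro x y hxy
    have hxy' : (x : ℝ) ≤ y := hxy
    have hf' : (f x : ℝ) ≤ f y := hf.1.monotone hxy
    rw [Subtype.dist_eq, Subtype.dist_eq, Real.dist_eq, Real.dist_eq, abs_sub_comm,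
      abs_sub_comm (x : ℝ), abs_of_nonneg (by linarith), abs_of_nonneg (by linarith)]
    exact hC x y hxy unitInterval.le_one'
  rcases le_total x y with h | h
  · exact hmain x y h
  · rw [dist_comm, dist_comm x]
    exact hmain y x h

theorem volume_unitInterval_eq (A : Set unitInterval) :
    (volume : Measure unitInterval) A = Measure.hausdorffMeasure 1 A := by
  rw [← (isometry_subtype_coe (s := unitInterval)).hausdorffMeasure_image (Or.inl zero_le_one),
    hausdorffMeasure_real, unitInterval.volume_apply]

theorem exists_volume_preimage_le (g : thompsonF) :
    ∃ C : ℝ, 0 ≤ C ∧ ∀ A : Set unitInterval,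
      (volume : Measure unitInterval).real (g.1 ⁻¹' A) ≤ C * volume.real A := by
  obtain ⟨K, hK⟩ := IsThompson.exists_lipschitz (f := (g⁻¹).1) (g⁻¹).2
  refine ⟨K, K.2, fun A => ?_⟩
  have h := hK.hausdorffMeasure_image_le zero_le_one A
  rw [← volume_unitInterval_eq, ← volume_unitInterval_eq, ENNReal.rpow_one] at h
  have himg : (g⁻¹).1 '' A = g.1 ⁻¹' A := g.1.symm.toEquiv.image_eq_preimage_symm A
  rw [himg] at h
  have := ENNReal.toReal_mono (ENNReal.mul_ne_top ENNReal.coe_ne_top (measure_ne_top _ _)) h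
  simpa [measureReal_def] using this

/-- The estimate behind the continuity of the multiplication. -/
theorem diffMeasure_mul_le (r : thompsonF) : ∃ C : ℝ, 0 ≤ C ∧
    ∀ f f' g g' : thompsonF, diffMeasure (f * g).1 (f' * g').1 ≤
      C * diffMeasure f.1 f'.1 + diffMeasure g.1 r.1 + diffMeasure g.1 g'.1 := by
  obtain ⟨C, hC0, hC⟩ := exists_volume_preimage_le r
  refine ⟨C, hC0, fun f f' g g' => ?_⟩
  have h1 := hC {x | f.1 x ≠ f'.1 x}
  have hsub : {x | (f * g).1 x ≠ (f' * g').1 x} ⊆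
      (r.1 ⁻¹' {x | f.1 x ≠ f'.1 x} ∪ {x | g.1 x ≠ r.1 x}) ∪ {x | g.1 x ≠ g'.1 x} := by
    intro x hx
    by_contra hc
    simp only [Set.mem_union, Set.mem_ofPred_eq, Set.mem_preimage, not_or, not_not] at hc
    obtain ⟨⟨h1, h2⟩, h3⟩ := hc
    apply hx
    change f.1 (g.1 x) = f'.1 (g'.1 x)
    rw [← h3, h2, h1]
  have h2 : diffMeasure (f * g).1 (f' * g').1 ≤ _ :=
    (measureReal_mono hsub).trans (measureReal_union_le _ _)
  have h3 := measureReal_union_le (μ := (volume : Measure unitInterval))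
    (r.1 ⁻¹' {x | f.1 x ≠ f'.1 x}) {x | g.1 x ≠ r.1 x}
  unfold diffMeasure at h2 ⊢
  linarith

theorem hammingDist_mul_le (r s : thompsonF) : ∃ C : ℝ, 0 ≤ C ∧
    ∀ f f' g g' : thompsonF, hammingDist (f * g) (f' * g') ≤
      C * (hammingDist f f' + hammingDist g g') + hammingDist f s + hammingDist g r := by
  obtain ⟨C, hC0, hC⟩ := diffMeasure_mul_le r
  obtain ⟨C', hC0', hC'⟩ := diffMeasure_mul_le s⁻¹
  refine ⟨C + C' + 1, by linarith, fun f f' g g' => ?_⟩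
  have h1 := hC f f' g g'
  have h2 := hC' g⁻¹ g'⁻¹ f⁻¹ f'⁻¹
  rw [← mul_inv_rev, ← mul_inv_rev] at h2
  have n1 := diffMeasure_nonneg f.1 f'.1
  have n2 := diffMeasure_nonneg g.1 g'.1
  have n3 := diffMeasure_nonneg (f⁻¹).1 (f'⁻¹).1
  have n4 := diffMeasure_nonneg (g⁻¹).1 (g'⁻¹).1
  have n5 := diffMeasure_nonneg f.1 s.1
  have n6 := diffMeasure_nonneg (g⁻¹).1 (r⁻¹).1
  unfold hammingDist
  nlinarith [mul_nonneg hC0 n1, mul_nonneg hC0 n2, mul_nonneg hC0 n3, mul_nonneg hC0 n4,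
    mul_nonneg hC0' n1, mul_nonneg hC0' n2, mul_nonneg hC0' n3, mul_nonneg hC0' n4]

end Aux

/-- The group of Cauchy sequences of elements of `F`, with termwise operations. -/
def hammingCauchy : Subgroup (ℕ → thompsonF) where
  carrier := {f | IsHammingCauchy f}
  one_mem' := by
    intro ε hε
    exact ⟨0, fun m _ n _ => by simpa [hammingDist, diffMeasure_self] using hε⟩
  mul_mem' := by
    intro f g hf hg ε hε
    obtain ⟨N₁, h₁⟩ := hf (ε / 4) (by linarith)
    obtain ⟨N₂, h₂⟩ := hg (ε / 4) (by linarith)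
    obtain ⟨C, hC0, hC⟩ := hammingDist_mul_le (g N₂) (f N₁)
    obtain ⟨N₃, h₃⟩ := hf (ε / 4 / (C + 1)) (by positivity)
    obtain ⟨N₄, h₄⟩ := hg (ε / 4 / (C + 1)) (by positivity)
    refine ⟨max (max N₁ N₂) (max N₃ N₄), fun m hm n hn => ?_⟩
    simp only [ge_iff_le, max_le_iff] at hm hn
    have a := hC (f m) (f n) (g m) (g n)
    have b1 := h₁ m hm.1.1 N₁ le_rfl
    have b2 := h₂ m hm.1.2 N₂ le_rfl
    have b3 := h₃ m hm.2.1 n hn.2.1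
    have b4 := h₄ m hm.2.2 n hn.2.2
    have e : C * (ε / 4 / (C + 1)) ≤ ε / 4 := by
      rw [mul_div_assoc', div_le_iff₀ (by linarith)]
      nlinarith
    have c := mul_le_mul_of_nonneg_left (add_le_add b3.le b4.le) hC0
    rw [Pi.mul_apply, Pi.mul_apply]
    linarith
  inv_mem' := by
    intro f hf ε hε
    obtain ⟨N, hN⟩ := hf ε hε
    exact ⟨N, fun m hm n hn => by
      rw [Pi.inv_apply, Pi.inv_apply, hammingDist_inv]; exact hN m hm n hn⟩

/-- Two Cauchy sequences `(f_n)`, `(g_n)` are equivalent if `dist_H(f_n, g_n) → 0`. -/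
def hammingCon : Con hammingCauchy where
  r f g := Filter.Tendsto (fun n => hammingDist (f.1 n) (g.1 n)) Filter.atTop (nhds 0)
  iseqv := by
    refine ⟨fun f => ?_, fun {f g} h => ?_, fun {f g k} h h' => ?_⟩
    · simp [hammingDist, diffMeasure_self]
    · simpa only [hammingDist_comm] using h
    · refine squeeze_zero (fun n => hammingDist_nonneg _ _)
        (fun n => hammingDist_triangle (f.1 n) (g.1 n) (k.1 n)) ?_
      simpa using h.add h'
  mul' := by
    intro f f' g g' h h'
    rw [Metric.tendsto_atTop] at h h' ⊢
    simp only [Real.dist_eq, sub_zero, abs_of_nonneg (hammingDist_nonneg _ _)] at h h' ⊢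
    intro ε hε
    obtain ⟨N₁, h₁⟩ := f.2 (ε / 4) (by linarith)
    obtain ⟨N₂, h₂⟩ := g.2 (ε / 4) (by linarith)
    obtain ⟨C, hC0, hC⟩ := hammingDist_mul_le (g.1 N₂) (f.1 N₁)
    obtain ⟨N₃, h₃⟩ := h (ε / 4 / (C + 1)) (by positivity)
    obtain ⟨N₄, h₄⟩ := h' (ε / 4 / (C + 1)) (by positivity)
    refine ⟨max (max N₁ N₂) (max N₃ N₄), fun n hn => ?_⟩
    simp only [ge_iff_le, max_le_iff] at hn
    have a := hC (f.1 n) (f'.1 n) (g.1 n) (g'.1 n)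
    have b1 := h₁ n hn.1.1 N₁ le_rfl
    have b2 := h₂ n hn.1.2 N₂ le_rfl
    have b3 := h₃ n hn.2.1
    have b4 := h₄ n hn.2.2
    have e : C * (ε / 4 / (C + 1)) ≤ ε / 4 := by
      rw [mul_div_assoc', div_le_iff₀ (by linarith)]
      nlinarith
    have c := mul_le_mul_of_nonneg_left (add_le_add b3.le b4.le) hC0
    change hammingDist (f.1 n * g.1 n) (f'.1 n * g'.1 n) < ε
    linarith

/-- The (Raikov) completion `F̄` of `F` with respect to the Hamming metric: the group of equivalence
classes of Cauchy sequences, with the termwise operations. -/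
abbrev HammingCompletion : Type := hammingCon.Quotient

/-! ### Amenability -/

/-- A (discrete) group is amenable if it has a left-invariant finitely additive probability measure
defined on all its subsets. -/
def IsAmenable (G : Type*) [Group G] : Prop :=
  ∃ m : Set G → ℝ, (∀ A, 0 ≤ m A) ∧ m Set.univ = 1 ∧
    (∀ A B, Disjoint A B → m (A ∪ B) = m A + m B) ∧
    ∀ (g : G) (A : Set G), m ((fun x => g * x) '' A) = m A

end Thompson

/-! Everything is done with order-preserving permutations of infinite binary words. Such a
permutation induces a homeomorphism of `[0,1]`, and this homomorphism is injective
(`inducedHomeo_injective`). If the permutation replaces a prefix near every word, the homeomorphism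
lies in `F` (`isThompson_inducedHomeo`). If this fails at only finitely many words, the
homeomorphism lies in `𝓕`.

The vertices `…, 001, 01, 10, 110, …` cut the open interval into dyadic intervals indexed by `ℤ`,
which accumulate only at `0` and `1`. Let one generator act as `x₀²` on every interval, and let the
other be its conjugate by a shift of half an interval. In each interval, the square `x₀²` sends
everything outside the quarter `00` into the quarter `11`. The conjugate does the same with the
quarters `10` and `01`. The four quarters are disjoint, so the ping-pong lemma gives a free group of
rank two (`lift_pingGen_injective`). The generators can be irregular only at the two end points,
hence this free group lies in `𝓕`.

For the completion, replace `x₀²` by the identity on the intervals with `|k| > n`. The result lies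
in `F`, and at every point it eventually equals the generator. A sequence in `F` that is pointwise
eventually equal to a homeomorphism is Hamming-Cauchy (`isHammingCauchy_of_mem`), and its class is
trivial only if that homeomorphism is the identity (`eq_one_of_limitClass`). So the free group
embeds in the completion.

Non-amenability then follows directly from the ping-pong (`not_isAmenable_of_pingPong`). An
invariant mean on the big group transports to the space acted on. There the attracting and repelling
sets of each generator together have mass at least one, and the two generators use disjoint sets. -/

namespace Thompson

open BinTree

/-! ### Values of infinite words and the lexicographic order -/

theorem val_cons (a : Fin 2) (ξ : InfWord) :
    (val (Stream'.cons a ξ) : ℝ) = ((a : ℕ) + val ξ) / 2 := by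
  have h := Real.ofDigits_eq_sum_add_ofDigits (b := 2) (Stream'.cons a ξ) 1
  have h1 : (fun i => Stream'.cons a ξ (i + 1)) = ξ := rfl
  have h2 : Stream'.cons a ξ 0 = a := rfl
  rw [h1, Finset.sum_range_one] at h
  simp only [Real.ofDigitsTerm, h2] at h
  change Real.ofDigits (b := 2) (Stream'.cons a ξ) = ((a : ℕ) + Real.ofDigits (b := 2) ξ) / 2
  rw [h]
  push_cast
  ring

theorem val_const_zero : (val (Stream'.const 0) : ℝ) = 0 := by
  have := val_cons 0 (Stream'.const 0)
  rw [← Stream'.const_eq] at this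
  simp only [Fin.val_zero] at this
  push_cast at this
  linarith

theorem val_append (u : Word) (ξ : InfWord) :
    (val (u ++ₛ ξ) : ℝ) = val (u ++ₛ Stream'.const 0) + (2 ^ u.length)⁻¹ * val ξ := by
  induction u with
  | nil => simp [val_const_zero]
  | cons a u ih =>
    rw [Stream'.cons_append_stream, Stream'.cons_append_stream, val_cons, ih, val_cons]
    simp only [List.length_cons, pow_succ]
    field_simp
    ring

theorem val_const_one : (val (Stream'.const 1) : ℝ) = 1 := by
  have := val_cons 1 (Stream'.const 1)
  rw [← Stream'.const_eq] at this
  simp only [Fin.val_one] at this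
  push_cast at this
  linarith

theorem val_surjective : Function.Surjective val := by
  intro x
  obtain ⟨ξ, -, hξ⟩ := Real.ofDigits_SurjOn (b := 2) (by norm_num) x.2
  exact ⟨ξ, Subtype.ext hξ⟩

theorem fin_two_cases (a : Fin 2) : a = 0 ∨ a = 1 := by
  revert a
  decide

theorem exists_eq_cons (ξ : InfWord) : ∃ η : InfWord, ξ = Stream'.cons 0 η ∨ ξ = Stream'.cons 1 η := by
  refine ⟨ξ.tail, ?_⟩
  rcases fin_two_cases ξ.head with h | h
  · exact Or.inl (by rw [← h, Stream'.eta])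
  · exact Or.inr (by rw [← h, Stream'.eta])

/-- A coinduction principle: `P` forces the first letter and is inherited by the tail, so it
determines every letter. -/
theorem eq_const_of_step (a : Fin 2) (P : InfWord → Prop)
    (hP : ∀ ξ, P ξ → ∃ η, ξ = Stream'.cons a η ∧ P η) {ξ : InfWord} (h : P ξ) :
    ξ = Stream'.const a := by
  apply Stream'.ext
  intro n
  induction n generalizing ξ with
  | zero =>
    obtain ⟨η, rfl, -⟩ := hP ξ h
    rfl
  | succ n ih =>
    obtain ⟨η, rfl, hη⟩ := hP ξ h
    rw [Stream'.get_succ_cons, ih hη]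
    rfl

theorem eq_const_zero_of_val {ξ : InfWord} (h : (val ξ : ℝ) = 0) : ξ = Stream'.const 0 := by
  refine eq_const_of_step 0 (fun ξ => (val ξ : ℝ) = 0) (fun ξ h => ?_) h
  obtain ⟨η, rfl | rfl⟩ := exists_eq_cons ξ
  · refine ⟨η, rfl, ?_⟩
    simpa [val_cons] using h
  · have := (val η).2.1
    rw [val_cons] at h
    norm_num at h
    linarith

theorem eq_const_one_of_val {ξ : InfWord} (h : (val ξ : ℝ) = 1) : ξ = Stream'.const 1 := by
  refine eq_const_of_step 1 (fun ξ => (val ξ : ℝ) = 1) (fun ξ h => ?_) h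
  obtain ⟨η, rfl | rfl⟩ := exists_eq_cons ξ
  · have := (val η).2.2
    rw [val_cons] at h
    norm_num at h
    linarith
  · refine ⟨η, rfl, ?_⟩
    rw [val_cons] at h
    norm_num at h
    linarith

theorem WordLT.val_le {ξ η : InfWord} (h : WordLT ξ η) : val ξ ≤ val η := by
  obtain ⟨w, α, β, rfl, rfl⟩ := h
  change (val _ : ℝ) ≤ val _
  rw [Stream'.append_append_stream, Stream'.append_append_stream, val_append, val_append w (_ ++ₛ β)]
  have h1 := (val α).2.2
  have h2 := (val β).2.1
  have h3 : (val ([0] ++ₛ α) : ℝ) ≤ val ([1] ++ₛ β) := by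
    rw [Stream'.append_eq_cons, Stream'.append_eq_cons, val_cons, val_cons, Fin.val_zero,
      Fin.val_one]
    push_cast
    linarith
  gcongr

theorem WordLT.of_val_lt {ξ η : InfWord} (h : val ξ < val η) : WordLT ξ η := by
  rcases WordLT.or_of_ne (fun e : ξ = η => h.ne (by rw [e])) with h' | h'
  · exact h'
  · exact (h'.val_le.not_gt h).elim

/-- The two binary expansions of a dyadic number. -/
theorem WordLT.eq_of_val_eq {ξ η : InfWord} (h : WordLT ξ η) (he : val ξ = val η) :
    ∃ w : Word, ξ = (w ++ [0]) ++ₛ Stream'.const 1 ∧ η = (w ++ [1]) ++ₛ Stream'.const 0 := by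
  obtain ⟨w, α, β, rfl, rfl⟩ := h
  have h1 := (val α).2.2
  have h2 := (val β).2.1
  have he' : (val ((w ++ [0]) ++ₛ α) : ℝ) = val ((w ++ [1]) ++ₛ β) := by rw [he]
  rw [Stream'.append_append_stream, Stream'.append_append_stream, val_append,
    val_append w (_ ++ₛ β), add_right_inj, mul_right_inj' (by positivity)] at he'
  simp only [Stream'.append_eq_cons, val_cons, Fin.val_zero, Fin.val_one] at he'
  push_cast at he'
  -- With the common prefix cancelled, `he'` says that `val α = 1 + val β`. Since both values lie in
  -- `[0,1]`, this forces `val α = 1` and `val β = 0`.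
  refine ⟨w, ?_, ?_⟩
  · rw [← eq_const_one_of_val (ξ := α) (by linarith)]
  · rw [← eq_const_zero_of_val (ξ := β) (by linarith)]

theorem append_const_ne (u v : Word) :
    u ++ₛ Stream'.const (0 : Fin 2) ≠ v ++ₛ Stream'.const (1 : Fin 2) := by
  intro h
  rcases append_eq_append_cases h with ⟨s, -, h⟩ | ⟨s, -, h⟩ <;>
  · have := congrArg (fun ξ : InfWord => ξ.get s.length) h
    simp only [Stream'.get_append_length, Stream'.get_const] at this
    exact absurd this (by decide)

/-- If the outer values agreed, the middle word would be both the upper expansion of a dyadic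
number, ending in `000…`, and the lower one, ending in `111…`. Thus words with equal values are
adjacent, and no three distinct words share a value. -/
theorem val_lt_of_between {ξ ω η : InfWord} (h1 : WordLT ξ ω) (h2 : WordLT ω η) :
    val ξ < val η := by
  refine lt_of_le_of_ne (h1.val_le.trans h2.val_le) fun he => ?_
  have e1 : val ξ = val ω := le_antisymm h1.val_le (he ▸ h2.val_le)
  obtain ⟨u, -, hu⟩ := h1.eq_of_val_eq e1
  obtain ⟨v, hv, -⟩ := h2.eq_of_val_eq (e1.symm.trans he)
  exact append_const_ne _ _ (hu.symm.trans hv)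

theorem exists_between_of_val_lt {ξ η : InfWord} (h : val ξ < val η) :
    ∃ ω, WordLT ξ ω ∧ WordLT ω η := by
  obtain ⟨x, h1, h2⟩ := exists_between h
  obtain ⟨ω, rfl⟩ := val_surjective x
  exact ⟨ω, .of_val_lt h1, .of_val_lt h2⟩

/-! ### Order-preserving permutations acting on the unit interval -/

/-- The order preserving permutations of the infinite words. -/
def monoPerm : Subgroup (Equiv.Perm InfWord) where
  carrier := {H | ∀ ξ η, WordLT ξ η → WordLT (H ξ) (H η)}
  one_mem' := fun _ _ h => h
  mul_mem' := fun hH hK _ _ h => hH _ _ (hK _ _ h)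
  inv_mem' := by
    intro H hH ξ η h
    have hne : H⁻¹ ξ ≠ H⁻¹ η := by
      intro e
      rw [H⁻¹.injective e] at h
      exact h.irrefl
    rcases WordLT.or_of_ne hne with h' | h'
    · exact h'
    · have := hH _ _ h'
      simp only [Equiv.Perm.coe_inv, Equiv.apply_symm_apply] at this
      exact (h.asymm this).elim

/-- Two distinct words have the same value exactly when no word lies between them, which is a
property of the order alone. A word between the images would pull back under `H⁻¹` to a word between
`ξ` and `η`. This makes the induced map well defined at dyadic numbers. -/
theorem val_apply_eq (H : monoPerm) {ξ η : InfWord} (h : val ξ = val η) :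
    val (H.1 ξ) = val (H.1 η) := by
  have key : ∀ {ξ η : InfWord}, WordLT ξ η → val ξ = val η → val (H.1 ξ) = val (H.1 η) := by
    intro ξ η hlt h
    by_contra hc
    obtain ⟨ω, h1, h2⟩ := exists_between_of_val_lt ((H.2 _ _ hlt).val_le.lt_of_ne hc)
    have h3 := H⁻¹.2 _ _ h1
    have h4 := H⁻¹.2 _ _ h2
    simp only [Subgroup.coe_inv, Equiv.Perm.coe_inv, Equiv.symm_apply_apply] at h3 h4
    exact (val_lt_of_between h3 h4).ne h
  by_cases he : ξ = η
  · rw [he]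
  · rcases WordLT.or_of_ne he with hlt | hlt
    · exact key hlt h
    · exact (key hlt h.symm).symm

/-- The map of `[0,1]` induced by an order preserving permutation of the infinite words. -/
noncomputable def inducedMap (H : monoPerm) (x : unitInterval) : unitInterval :=
  val (H.1 (Function.surjInv val_surjective x))

theorem inducedMap_val (H : monoPerm) (ξ : InfWord) : inducedMap H (val ξ) = val (H.1 ξ) :=
  val_apply_eq H (Function.surjInv_eq val_surjective _)

theorem inducedMap_mul (H K : monoPerm) (x : unitInterval) :
    inducedMap (H * K) x = inducedMap H (inducedMap K x) := by
  obtain ⟨ξ, rfl⟩ := val_surjective x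
  simp only [inducedMap_val]
  rfl

theorem inducedMap_one (x : unitInterval) : inducedMap 1 x = x := by
  obtain ⟨ξ, rfl⟩ := val_surjective x
  rw [inducedMap_val]
  rfl

theorem inducedMap_monotone (H : monoPerm) : Monotone (inducedMap H) := by
  intro x y hxy
  rcases hxy.eq_or_lt with rfl | hxy
  · exact le_rfl
  · obtain ⟨ξ, rfl⟩ := val_surjective x
    obtain ⟨η, rfl⟩ := val_surjective y
    rw [inducedMap_val, inducedMap_val]
    exact (H.2 _ _ (.of_val_lt hxy)).val_le

/-- The order automorphism of `[0,1]` induced by an order preserving permutation. -/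
noncomputable def inducedIso (H : monoPerm) : unitInterval ≃o unitInterval :=
  Equiv.toOrderIso
    { toFun := inducedMap H
      invFun := inducedMap H⁻¹
      left_inv := fun x => by rw [← inducedMap_mul, inv_mul_cancel, inducedMap_one]
      right_inv := fun x => by rw [← inducedMap_mul, mul_inv_cancel, inducedMap_one] }
    (inducedMap_monotone H) (inducedMap_monotone H⁻¹)

/-- The action on `[0,1]` of the order preserving permutations of the infinite words. -/
noncomputable def inducedHomeo : monoPerm →* (unitInterval ≃ₜ unitInterval) where
  toFun H := (inducedIso H).toHomeomorph
  map_one' := Homeomorph.ext inducedMap_one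
  map_mul' H K := Homeomorph.ext (inducedMap_mul H K)

theorem inducedHomeo_val (H : monoPerm) (ξ : InfWord) : inducedHomeo H (val ξ) = val (H.1 ξ) :=
  inducedMap_val H ξ

theorem inducedHomeo_strictMono (H : monoPerm) : StrictMono (inducedHomeo H) :=
  (inducedIso H).strictMono

/-- A permutation `K` acting trivially on `[0,1]` could still move a word to another expansion of
the same number. But from `ξ < K ξ` follows `ξ < K ξ < K (K ξ)`, three words with one value.
Downward moves are handled by the inverse. -/
theorem inducedHomeo_injective : Function.Injective inducedHomeo := by
  rw [injective_iff_map_eq_one]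
  intro H hH
  have hval : ∀ (K : monoPerm), inducedHomeo K = 1 → ∀ ξ, val (K.1 ξ) = val ξ := by
    intro K hK ξ
    rw [← inducedHomeo_val, hK]
    rfl
  have key : ∀ (K : monoPerm), inducedHomeo K = 1 → ∀ ξ, ¬ WordLT ξ (K.1 ξ) := by
    intro K hK ξ h
    refine (val_lt_of_between h (K.2 _ _ h)).ne ?_
    rw [hval K hK, hval K hK]
  ext ξ : 2
  by_contra hc
  rcases WordLT.or_of_ne hc with h | h
  · refine key H⁻¹ (by rw [map_inv, hH, inv_one]) (H.1 ξ) ?_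
    simpa using h
  · exact key H hH ξ h

theorem inducedHomeo_mem_treeGroup {H : monoPerm} (h : IsTreeLike H.1) :
    inducedHomeo H ∈ treeGroup :=
  exists_represents_iff.2 ⟨H.1, h, inducedHomeo_val H⟩

/-! ### Permutations that are regular everywhere give elements of `F` -/

theorem isDyadic_val (u : Word) : IsDyadic (val (u ++ₛ Stream'.const 0)) := by
  induction u with
  | nil => exact ⟨0, 0, by simp [val_const_zero]⟩
  | cons a u ih =>
    rw [Stream'.cons_append_stream, val_cons]
    have h1 : IsDyadic ((a : ℕ) : ℝ) := ⟨(a : ℕ), 0, by simp⟩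
    have := (h1.add ih).zpow_mul (-1)
    rwa [zpow_neg_one, ← div_eq_inv_mul] at this

theorem val_append_one (u : Word) :
    (val (u ++ₛ Stream'.const 1) : ℝ) = val (u ++ₛ Stream'.const 0) + (2 ^ u.length)⁻¹ := by
  rw [val_append, val_const_one, mul_one]

theorem take_eq_of_get_eq {ξ η : InfWord} {n : ℕ} (h : ∀ i < n, ξ.get i = η.get i) :
    ξ.take n = η.take n := by
  induction n with
  | zero => rfl
  | succ n ih =>
    rw [Stream'.take_succ', Stream'.take_succ', ih fun i hi => h i (hi.trans n.lt_succ_self),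
      h n n.lt_succ_self]

/-- Compactness of the Cantor space: the cylinders on which `H` is a prefix replacement form an open
cover. -/
theorem exists_finite_cover {H : InfWord → InfWord} (hH : ∀ ξ, RegularAt H ξ) :
    ∃ t : Finset Word, (∀ u ∈ t, ∃ v, Replaces H u v) ∧ ∀ ξ : InfWord, ∃ u ∈ t, ∃ α, ξ = u ++ₛ α := by
  choose u v α hu huv using hH
  -- The cylinder of the prefix `u ξ`, written with coordinates so that the product topology
  -- applies.
  let U : (ℕ → Fin 2) → Set (ℕ → Fin 2) := fun ξ => {η | ∀ i < (u ξ).length, η i = ξ i}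
  have hopen : ∀ ξ, IsOpen (U ξ) := by
    intro ξ
    have : U ξ = ⋂ i ∈ Finset.range (u ξ).length, (fun η : ℕ → Fin 2 => η i) ⁻¹' {ξ i} := by
      ext η
      simp [U]
    rw [this]
    exact isOpen_biInter_finset fun i _ => (isOpen_discrete _).preimage (continuous_apply i)
  obtain ⟨t, ht⟩ := isCompact_univ.elim_finite_subcover U hopen
    (fun ξ _ => Set.mem_iUnion.2 ⟨ξ, fun _ _ => rfl⟩)
  classical
  refine ⟨t.image u, ?_, fun η => ?_⟩
  · intro w hw
    obtain ⟨ξ, -, rfl⟩ := Finset.mem_image.1 hw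
    exact ⟨v ξ, huv ξ⟩
  · obtain ⟨ξ, hξ, hη⟩ := Set.mem_iUnion₂.1 (ht (Set.mem_univ η))
    refine ⟨u ξ, Finset.mem_image_of_mem _ hξ, Stream'.drop (u ξ).length η, ?_⟩
    have h1 : Stream'.take (u ξ).length η = u ξ := by
      have h2 : Stream'.take (u ξ).length ξ = u ξ := by
        have := take_length_append (u ξ) (α ξ)
        rwa [← hu ξ] at this
      exact (take_eq_of_get_eq hη).trans h2
    have h3 := Stream'.append_take_drop (u ξ).length η
    rw [h1] at h3
    exact h3.symm

/-- The end points of the finitely many dyadic intervals `[u]` of the cover serve as break points.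
An interval with none of them in its interior lies inside a single `[u]`, where replacing `u` by `v`
is linear with slope `2 ^ (|u| - |v|)`. -/
theorem isThompson_inducedHomeo {H : monoPerm} (h : ∀ ξ, RegularAt H.1 ξ) :
    IsThompson (inducedHomeo H) := by
  classical
  obtain ⟨t, ht, hcov⟩ := exists_finite_cover h
  refine ⟨inducedHomeo_strictMono H, t.image (fun u => val (u ++ₛ Stream'.const 0)) ∪
    t.image (fun u => val (u ++ₛ Stream'.const 1)), ?_, ?_⟩
  · intro s hs
    rcases Finset.mem_union.1 hs with hs | hs
    · obtain ⟨u, -, rfl⟩ := Finset.mem_image.1 hs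
      exact isDyadic_val u
    · obtain ⟨u, -, rfl⟩ := Finset.mem_image.1 hs
      rw [val_append_one]
      exact (isDyadic_val u).add ⟨1, u.length, by simp⟩
  · intro a b hab hS
    -- An interior point selects the interval `[u]` of the cover. Because it is strictly inside, an
    -- end point of `[u]` within `(a, b)` would contradict `hS`.
    obtain ⟨c, hac, hcb⟩ := exists_between hab
    obtain ⟨ξ, rfl⟩ := val_surjective c
    obtain ⟨u, hu, γ, rfl⟩ := hcov ξ
    obtain ⟨v, huv⟩ := ht u hu
    have hγ := val_append u γ
    have hl : val (u ++ₛ Stream'.const 0) ≤ a := by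
      by_contra hc
      refine hS _ (Finset.mem_union_left _ (Finset.mem_image_of_mem _ hu)) ⟨not_le.1 hc, ?_⟩
      refine lt_of_le_of_lt ?_ hcb
      change (val _ : ℝ) ≤ val _
      rw [hγ]
      have := (val γ).2.1
      have : (0 : ℝ) ≤ (2 ^ u.length)⁻¹ * val γ := by positivity
      linarith
    have hr : b ≤ val (u ++ₛ Stream'.const 1) := by
      by_contra hc
      refine hS _ (Finset.mem_union_right _ (Finset.mem_image_of_mem _ hu)) ⟨?_, not_le.1 hc⟩
      refine lt_of_lt_of_le hac ?_
      change (val _ : ℝ) ≤ val _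
      rw [hγ, val_append_one]
      have := mul_le_of_le_one_right (a := ((2 : ℝ) ^ u.length)⁻¹) (by positivity) (val γ).2.2
      linarith
    -- A dyadic end point has two expansions; only the existence of one with prefix `u` is needed.
    have key : ∀ x ∈ Set.Icc a b, ∃ α, x = val (u ++ₛ α) := by
      intro x hx
      have h1 : (val (u ++ₛ Stream'.const 0) : ℝ) ≤ x := hl.trans hx.1
      have h2 : (x : ℝ) ≤ val (u ++ₛ Stream'.const 1) := hx.2.trans hr
      rw [val_append_one] at h2
      have h3 : (0 : ℝ) < 2 ^ u.length := by positivity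
      obtain ⟨α, hα⟩ := val_surjective
        ⟨2 ^ u.length * ((x : ℝ) - val (u ++ₛ Stream'.const 0)), by
          constructor
          · exact mul_nonneg h3.le (by linarith)
          · rw [← le_div_iff₀' h3, one_div]
            linarith⟩
      refine ⟨α, Subtype.ext ?_⟩
      rw [val_append, hα]
      simp only
      field_simp
      ring
    have hlin : ∀ α β : InfWord, (inducedHomeo H (val (u ++ₛ β)) : ℝ) =
        inducedHomeo H (val (u ++ₛ α)) + 2 ^ ((u.length : ℤ) - v.length) *
          ((val (u ++ₛ β) : ℝ) - val (u ++ₛ α)) := by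
      intro α β
      rw [inducedHomeo_val, inducedHomeo_val, huv, huv, val_append v, val_append v α,
        val_append u, val_append u α, zpow_sub₀ (by norm_num), zpow_natCast, zpow_natCast]
      field_simp
      ring
    obtain ⟨α, hα⟩ := key a ⟨le_rfl, hab.le⟩
    refine ⟨(u.length : ℤ) - v.length, fun x hx => ?_⟩
    obtain ⟨β, rfl⟩ := key x hx
    rw [hα]
    exact hlin α β

end Thompson


namespace Thompson

open BinTree Equiv

/-- This recursion reduces monotonicity of explicit prefix replacements to finite case checks. -/
theorem wordLT_cons {a b : Fin 2} {ξ η : InfWord} :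
    WordLT (Stream'.cons a ξ) (Stream'.cons b η) ↔ (a = 0 ∧ b = 1) ∨ (a = b ∧ WordLT ξ η) := by
  constructor
  · rintro ⟨w, α, β, h1, h2⟩
    cases w with
    | nil =>
      exact Or.inl ⟨congrArg Stream'.head h1, congrArg Stream'.head h2⟩
    | cons c w =>
      rw [List.cons_append, Stream'.cons_append_stream] at h1 h2
      refine Or.inr ⟨(congrArg Stream'.head h1).trans (congrArg Stream'.head h2).symm, w, α, β,
        congrArg Stream'.tail h1, congrArg Stream'.tail h2⟩
  · rintro (⟨rfl, rfl⟩ | ⟨rfl, h⟩)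
    · exact ⟨[], ξ, η, rfl, rfl⟩
    · exact h.append (u := [a])

/-! ### Regular points -/

/-- The prefix produced by `K` and the prefix consumed by `H` both begin `K ξ`, so one extends the
other. Lengthening the shorter replacement makes them match. -/
theorem RegularAt.mul {H K : Perm InfWord} {ξ : InfWord} (hH : RegularAt H (K ξ))
    (hK : RegularAt K ξ) : RegularAt (H * K : Perm InfWord) ξ := by
  obtain ⟨u, v, α, rfl, huv⟩ := hK
  obtain ⟨u', v', α', hα', huv'⟩ := hH
  rw [huv α] at hα'
  rcases append_eq_append_cases hα' with ⟨s, hs, rfl⟩ | ⟨s, hs, hs'⟩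
  · refine ⟨u ++ s, v', α', by simp [Stream'.append_append_stream], fun β => ?_⟩
    rw [Perm.mul_apply, Stream'.append_append_stream, huv, ← Stream'.append_append_stream,
      ← hs, huv']
  · refine ⟨u, v' ++ s, α, rfl, fun β => ?_⟩
    rw [Perm.mul_apply, huv, hs, Stream'.append_append_stream, huv',
      Stream'.append_append_stream]

theorem RegularAt.inv {H : Perm InfWord} {ξ : InfWord} (hH : RegularAt H (H⁻¹ ξ)) :
    RegularAt (H⁻¹ : Perm InfWord) ξ := by
  obtain ⟨u, v, α, hα, huv⟩ := hH
  refine ⟨v, u, α, ?_, huv.symm⟩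
  rw [← huv α, ← hα]
  simp

theorem regularAt_one (ξ : InfWord) : RegularAt (1 : Perm InfWord) ξ :=
  ⟨[], [], ξ, rfl, fun _ => rfl⟩

/-! ### The generator `x₀` of `F` -/

/-- The permutation `00 ↦ 0`, `01 ↦ 10`, `1 ↦ 11` of the infinite words. -/
def genX : Perm InfWord where
  toFun ξ := if ξ.head = 0 then
      if ξ.tail.head = 0 then Stream'.cons 0 ξ.tail.tail
      else Stream'.cons 1 (Stream'.cons 0 ξ.tail.tail)
    else Stream'.cons 1 (Stream'.cons 1 ξ.tail)
  invFun ξ := if ξ.head = 0 then Stream'.cons 0 (Stream'.cons 0 ξ.tail)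
    else if ξ.tail.head = 0 then Stream'.cons 0 (Stream'.cons 1 ξ.tail.tail)
      else Stream'.cons 1 ξ.tail.tail
  left_inv ξ := by
    obtain ⟨η, rfl | rfl⟩ := exists_eq_cons ξ
    · obtain ⟨ζ, rfl | rfl⟩ := exists_eq_cons η <;> simp
    · simp
  right_inv ξ := by
    obtain ⟨η, rfl | rfl⟩ := exists_eq_cons ξ
    · simp
    · obtain ⟨ζ, rfl | rfl⟩ := exists_eq_cons η <;> simp

theorem genX_zero_zero (ξ : InfWord) :
    genX (Stream'.cons 0 (Stream'.cons 0 ξ)) = Stream'.cons 0 ξ := by simp [genX]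

theorem genX_zero_one (ξ : InfWord) :
    genX (Stream'.cons 0 (Stream'.cons 1 ξ)) = Stream'.cons 1 (Stream'.cons 0 ξ) := by simp [genX]

theorem genX_one (ξ : InfWord) :
    genX (Stream'.cons 1 ξ) = Stream'.cons 1 (Stream'.cons 1 ξ) := by simp [genX]

theorem genX_mem_monoPerm : genX ∈ monoPerm := by
  intro ξ η h
  obtain ⟨ξ, rfl | rfl⟩ := exists_eq_cons ξ
  · obtain ⟨ξ, rfl | rfl⟩ := exists_eq_cons ξ
    all_goals
      obtain ⟨η, rfl | rfl⟩ := exists_eq_cons η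
      · obtain ⟨η, rfl | rfl⟩ := exists_eq_cons η
        all_goals simp [genX_zero_zero, genX_zero_one, wordLT_cons] at h ⊢ <;> exact h
      · simp [genX_zero_zero, genX_zero_one, genX_one, wordLT_cons]
  · obtain ⟨η, rfl | rfl⟩ := exists_eq_cons η
    · simp [wordLT_cons] at h
    · simpa [genX_one, wordLT_cons] using h

theorem regularAt_genX (ξ : InfWord) : RegularAt genX ξ := by
  obtain ⟨ξ, rfl | rfl⟩ := exists_eq_cons ξ
  · obtain ⟨ξ, rfl | rfl⟩ := exists_eq_cons ξ
    · exact ⟨[0, 0], [0], ξ, rfl, genX_zero_zero⟩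
    · exact ⟨[0, 1], [1, 0], ξ, rfl, genX_zero_one⟩
  · exact ⟨[1], [1, 1], ξ, rfl, genX_one⟩

/-! ### The decomposition of the open unit interval into a sequence of dyadic intervals -/

/-- The vertices `…, 001, 01, 10, 110, …`. -/
def spine : ℤ → Word
  | .ofNat n => List.replicate (n + 1) 1 ++ [0]
  | .negSucc n => List.replicate (n + 1) 0 ++ [1]

/-- The spine vertices branch off the path `111…` for `k ≥ 0` and off `000…` for `k < 0`, so two of
them separate where the first one leaves the common path, or at the root if the signs differ. Hence
the spine is prefix-free and ordered like `ℤ`. -/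
theorem exists_spine_split {k l : ℤ} (h : k < l) :
    ∃ w s t, spine k = w ++ [0] ++ s ∧ spine l = w ++ [1] ++ t := by
  rcases k with m | m <;> rcases l with n | n
  · obtain ⟨d, rfl⟩ := Nat.exists_eq_add_of_lt (Int.ofNat_lt.1 h)
    refine ⟨List.replicate (m + 1) 1, [], List.replicate d 1 ++ [0], by simp [spine], ?_⟩
    rw [spine, show m + d + 1 + 1 = (m + 1) + (d + 1) by ring, List.replicate_add,
      List.replicate_succ (n := d)]
    simp
  · rw [Int.ofNat_eq_natCast, Int.negSucc_eq] at h
    omega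
  · exact ⟨[], List.replicate m 0 ++ [1], List.replicate n 1 ++ [0], by
      simp [spine, List.replicate_succ], by simp [spine, List.replicate_succ]⟩
  · obtain ⟨d, rfl⟩ := Nat.exists_eq_add_of_lt (show n < m by omega)
    refine ⟨List.replicate (n + 1) 0, List.replicate d 0 ++ [1], [], ?_, by simp [spine]⟩
    rw [spine, show n + d + 1 + 1 = (n + 1) + (d + 1) by ring, List.replicate_add,
      List.replicate_succ (n := d)]
    simp

/-- The lexicographic order on `ℤ × InfWord`. -/
def LexLT (p q : ℤ × InfWord) : Prop := p.1 < q.1 ∨ (p.1 = q.1 ∧ WordLT p.2 q.2)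

theorem LexLT.spine_append {p q : ℤ × InfWord} (h : LexLT p q) :
    WordLT (spine p.1 ++ₛ p.2) (spine q.1 ++ₛ q.2) := by
  rcases h with h | ⟨h, h'⟩
  · obtain ⟨w, s, t, hs, ht⟩ := exists_spine_split h
    exact ⟨w, s ++ₛ p.2, t ++ₛ q.2, by rw [hs, Stream'.append_append_stream],
      by rw [ht, Stream'.append_append_stream]⟩
  · rw [h]
    exact h'.append

theorem LexLT.or_of_ne {p q : ℤ × InfWord} (h : p ≠ q) : LexLT p q ∨ LexLT q p := by
  rcases lt_trichotomy p.1 q.1 with h1 | h1 | h1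
  · exact Or.inl (Or.inl h1)
  · rcases WordLT.or_of_ne (fun h2 : p.2 = q.2 => h (Prod.ext h1 h2)) with h2 | h2
    · exact Or.inl (Or.inr ⟨h1, h2⟩)
    · exact Or.inr (Or.inr ⟨h1.symm, h2⟩)
  · exact Or.inr (Or.inl h1)

/-- The words different from `000…` and `111…`. -/
def spineEmb : ℤ × InfWord ↪ InfWord where
  toFun p := spine p.1 ++ₛ p.2
  inj' := by
    intro p q h
    by_contra hne
    rcases LexLT.or_of_ne hne with h' | h' <;>
    · have := h'.spine_append
      simp only at h
      rw [h] at this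
      exact this.irrefl

theorem spineEmb_apply (k : ℤ) (ξ : InfWord) : spineEmb (k, ξ) = spine k ++ₛ ξ := rfl

theorem wordLT_spineEmb {p q : ℤ × InfWord} :
    WordLT (spineEmb p) (spineEmb q) ↔ LexLT p q := by
  refine ⟨fun h => ?_, LexLT.spine_append⟩
  rcases LexLT.or_of_ne (fun e : p = q => (e ▸ h).irrefl) with h' | h'
  · exact h'
  · exact (h.asymm h'.spine_append).elim

theorem forall_mem_of_append_eq_const {a : Fin 2} {u : Word} {α : InfWord}
    (h : u ++ₛ α = Stream'.const a) : ∀ x ∈ u, x = a := by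
  induction u with
  | nil => simp
  | cons b u ih =>
    rw [Stream'.cons_append_stream, Stream'.const_eq] at h
    intro x hx
    rcases List.mem_cons.1 hx with rfl | hx
    · exact congrArg Stream'.head h
    · exact ih (congrArg Stream'.tail h) x hx

theorem const_notMem_range (a : Fin 2) : Stream'.const a ∉ Set.range spineEmb := by
  rintro ⟨⟨k, ξ⟩, h⟩
  have h0 : (0 : Fin 2) ∈ spine k := by rcases k with n | n <;> simp [spine]
  have h1 : (1 : Fin 2) ∈ spine k := by rcases k with n | n <;> simp [spine]
  have e0 := forall_mem_of_append_eq_const h 0 h0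
  have e1 := forall_mem_of_append_eq_const h 1 h1
  rw [← e1] at e0
  exact absurd e0 (by decide)

/-- Cut at the first letter different from `a`. The bound `m ≥ n` is what later turns closeness to
an end point into a large spine index. -/
theorem exists_replicate_append {a : Fin 2} {n : ℕ} {ξ : InfWord} (hn : ∀ i < n, ξ.get i = a)
    (h : ξ ≠ Stream'.const a) :
    ∃ m ≥ n, ∃ b ≠ a, ∃ η, ξ = (List.replicate m a ++ [b]) ++ₛ η := by
  classical
  have hex : ∃ m, ξ.get m ≠ a := by
    by_contra! hc
    exact h (Stream'.ext hc)
  have htake : ξ.take (Nat.find hex) = List.replicate (Nat.find hex) a := by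
    rw [take_eq_of_get_eq (η := Stream'.const a)
      fun i hi => not_not.1 (Nat.find_min hex hi)]
    generalize Nat.find hex = m
    induction m with
    | zero => rfl
    | succ m ih => rw [Stream'.take_succ', ih, List.replicate_succ']; rfl
  refine ⟨Nat.find hex, ?_, ξ.get (Nat.find hex), Nat.find_spec hex, ξ.drop (Nat.find hex + 1), ?_⟩
  · by_contra! hc
    exact Nat.find_spec hex (hn _ hc)
  · rw [← htake, Stream'.concat_take_get, Stream'.append_take_drop]

/-- The vertex with a run of `j + 1` zeros has index `-(j + 1)`, whereas the one with `j + 1` ones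
has index `j`. So `n + 1` leading zeros give `|k| > n`, but `n + 2` leading ones are needed in the
companion `exists_spineEmb_of_one`. -/
theorem exists_spineEmb_of_zero {n : ℕ} {ξ : InfWord} (hn : ∀ i < n + 1, ξ.get i = 0)
    (h : ξ ≠ Stream'.const 0) : ∃ k η, (n : ℤ) < |k| ∧ ξ = spineEmb (k, η) := by
  obtain ⟨m, hm, b, hb, η, rfl⟩ := exists_replicate_append hn h
  obtain ⟨m, rfl⟩ := Nat.exists_eq_add_of_le hm
  obtain rfl : b = 1 := Fin.eq_one_of_ne_zero b hb
  refine ⟨Int.negSucc (n + m), η, ?_, ?_⟩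
  · rw [Int.negSucc_eq, abs_neg, abs_of_nonneg (by positivity)]
    push_cast
    linarith
  · rw [spineEmb_apply, spine, show n + 1 + m = n + m + 1 by ring]

theorem exists_spineEmb_of_one {n : ℕ} {ξ : InfWord} (hn : ∀ i < n + 2, ξ.get i = 1)
    (h : ξ ≠ Stream'.const 1) : ∃ k η, (n : ℤ) < |k| ∧ ξ = spineEmb (k, η) := by
  obtain ⟨m, hm, b, hb, η, rfl⟩ := exists_replicate_append hn h
  obtain ⟨m, rfl⟩ := Nat.exists_eq_add_of_le hm
  obtain rfl : b = 0 := (fin_two_cases b).resolve_right hb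
  refine ⟨Int.ofNat (n + 1 + m), η, ?_, ?_⟩
  · rw [Int.ofNat_eq_natCast, abs_of_nonneg (by positivity)]
    push_cast
    linarith
  · rw [spineEmb_apply, spine, show n + 2 + m = n + 1 + m + 1 by ring]

theorem eq_const_or_exists_spineEmb (ξ : InfWord) :
    ξ = Stream'.const 0 ∨ ξ = Stream'.const 1 ∨ ∃ p, ξ = spineEmb p := by
  by_contra! hc
  obtain ⟨h0, h1, hp⟩ := hc
  rcases fin_two_cases ξ.head with h | h
  · obtain ⟨k, η, -, e⟩ := exists_spineEmb_of_zero (n := 0) (by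
      intro i hi
      obtain rfl : i = 0 := by omega
      exact h) h0
    exact hp _ e
  -- `exists_spineEmb_of_one` asks for two leading ones and would miss the words `10…` of the
  -- interval with index `0`, so the word is split directly.
  · obtain ⟨m, hm, b, hb, η, e⟩ := exists_replicate_append (n := 1) (by
      intro i hi
      obtain rfl : i = 0 := by omega
      exact h) h1
    obtain ⟨m, rfl⟩ := Nat.exists_eq_add_of_le hm
    obtain rfl : b = 0 := (fin_two_cases b).resolve_right hb
    refine hp (Int.ofNat m, η) ?_
    rw [e, spineEmb_apply, spine, add_comm 1 m]

theorem not_wordLT_const_zero (ξ : InfWord) : ¬ WordLT ξ (Stream'.const 0) := by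
  rw [wordLT_iff]
  rintro ⟨n, -, -, h⟩
  exact absurd h (by simp)

theorem not_const_one_wordLT (ξ : InfWord) : ¬ WordLT (Stream'.const 1) ξ := by
  rw [wordLT_iff]
  rintro ⟨n, -, h, -⟩
  exact absurd h (by simp)

/-- The permutation of the infinite words which fixes `000…` and `111…` and acts on the other words
as prescribed. -/
noncomputable abbrev extendSpine : Perm (ℤ × InfWord) →* Perm InfWord :=
  Perm.viaEmbeddingHom spineEmb

theorem extendSpine_apply (e : Perm (ℤ × InfWord)) (p : ℤ × InfWord) :
    extendSpine e (spineEmb p) = spineEmb (e p) :=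
  Perm.viaEmbedding_apply e spineEmb p

theorem extendSpine_const (e : Perm (ℤ × InfWord)) (a : Fin 2) :
    extendSpine e (Stream'.const a) = Stream'.const a :=
  Perm.viaEmbedding_apply_of_notMem e spineEmb _ (const_notMem_range a)

/-- The two fixed words are the least and the greatest, so they cannot violate the order. Between
the others the order is that of `LexLT`. -/
theorem extendSpine_mem_monoPerm {e : Perm (ℤ × InfWord)}
    (he : ∀ p q, LexLT p q → LexLT (e p) (e q)) : extendSpine e ∈ monoPerm := by
  intro ξ η h
  have hne : extendSpine e ξ ≠ extendSpine e η := fun e' =>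
    (((extendSpine e).injective e') ▸ h : WordLT η η).irrefl
  rcases WordLT.or_of_ne hne with h' | h'
  · exact h'
  exfalso
  obtain rfl | rfl | ⟨p, rfl⟩ := eq_const_or_exists_spineEmb ξ
  · rw [extendSpine_const] at h'
    exact not_wordLT_const_zero _ h'
  · exact not_const_one_wordLT _ h
  · obtain rfl | rfl | ⟨q, rfl⟩ := eq_const_or_exists_spineEmb η
    · exact not_wordLT_const_zero _ h
    · rw [extendSpine_const] at h'
      exact not_const_one_wordLT _ h'
    · rw [extendSpine_apply, extendSpine_apply] at h'
      exact h'.asymm (wordLT_spineEmb.2 (he _ _ (wordLT_spineEmb.1 h)))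

/-- A permutation which is trivial far away is regular at the end points. -/
theorem regularAt_extendSpine_const {e : Perm (ℤ × InfWord)} {n : ℕ}
    (he : ∀ k ξ, (n : ℤ) < |k| → e (k, ξ) = (k, ξ)) (a : Fin 2) :
    RegularAt (extendSpine e) (Stream'.const a) := by
  have hget : ∀ (b : Fin 2) (m i : ℕ) (α : InfWord), i < m →
      (List.replicate m b ++ₛ α).get i = b := by
    intro b m i α hi
    rw [Stream'.get_append_left i _ _ (by simpa using hi)]
    simp
  have hconst : ∀ (b : Fin 2) (m : ℕ), Stream'.const b = List.replicate m b ++ₛ Stream'.const b := by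
    intro b m
    induction m with
    | zero => rfl
    | succ m ih => rw [List.replicate_succ, Stream'.cons_append_stream, ← ih, ← Stream'.const_eq]
  -- The length `n + 2` suffices at both ends: every word with this prefix, other than the constant
  -- one, lies in an interval with `|k| > n`, so the prefix is replaced by itself.
  refine ⟨List.replicate (n + 2) a, List.replicate (n + 2) a, _, hconst a _, fun α => ?_⟩
  generalize hξ : List.replicate (n + 2) a ++ₛ α = ξ
  have hg : ∀ i < n + 2, ξ.get i = a := fun i hi => by rw [← hξ, hget _ _ _ _ hi]
  by_cases hc : ξ = Stream'.const a
  · rw [hc, extendSpine_const]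
  · have : ∃ k η, (n : ℤ) < |k| ∧ ξ = spineEmb (k, η) := by
      rcases fin_two_cases a with rfl | rfl
      · exact exists_spineEmb_of_zero (fun i hi => hg i (by omega)) hc
      · exact exists_spineEmb_of_one hg hc
    obtain ⟨k, η, hk, e'⟩ := this
    rw [e', extendSpine_apply, he k η hk]

/-! ### Permutations preserving the intervals, and the half shift -/

theorem extendSpine_prodCongrRight_mem {f : ℤ → Perm InfWord} (hf : ∀ k, f k ∈ monoPerm) :
    extendSpine (prodCongrRight f) ∈ monoPerm := by
  apply extendSpine_mem_monoPerm
  rintro ⟨k, ξ⟩ ⟨l, η⟩ (h | ⟨rfl, h⟩)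
  · exact Or.inl h
  · exact Or.inr ⟨rfl, hf _ _ _ h⟩

theorem regularAt_extendSpine_prodCongrRight {f : ℤ → Perm InfWord}
    (hf : ∀ k ξ, RegularAt (f k) ξ) (p : ℤ × InfWord) :
    RegularAt (extendSpine (prodCongrRight f)) (spineEmb p) := by
  obtain ⟨k, ξ⟩ := p
  obtain ⟨u, v, α, rfl, huv⟩ := hf k ξ
  refine ⟨spine k ++ u, spine k ++ v, α, ?_, fun β => ?_⟩
  · rw [spineEmb_apply, Stream'.append_append_stream]
  · rw [Stream'.append_append_stream, ← spineEmb_apply, extendSpine_apply, prodCongrRight_apply,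
      huv, spineEmb_apply, Stream'.append_append_stream]

/-- The shift by half an interval. -/
def halfShift : Perm (ℤ × InfWord) where
  toFun p := if p.2.head = 0 then (p.1, Stream'.cons 1 p.2.tail) else
    (p.1 + 1, Stream'.cons 0 p.2.tail)
  invFun p := if p.2.head = 0 then (p.1 - 1, Stream'.cons 1 p.2.tail) else
    (p.1, Stream'.cons 0 p.2.tail)
  left_inv := by
    rintro ⟨k, ξ⟩
    obtain ⟨η, rfl | rfl⟩ := exists_eq_cons ξ <;> simp
  right_inv := by
    rintro ⟨k, ξ⟩
    obtain ⟨η, rfl | rfl⟩ := exists_eq_cons ξ <;> simp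

theorem halfShift_zero (k : ℤ) (ξ : InfWord) :
    halfShift (k, Stream'.cons 0 ξ) = (k, Stream'.cons 1 ξ) := by simp [halfShift]

theorem halfShift_one (k : ℤ) (ξ : InfWord) :
    halfShift (k, Stream'.cons 1 ξ) = (k + 1, Stream'.cons 0 ξ) := by simp [halfShift]

theorem extendSpine_halfShift_mem : extendSpine halfShift ∈ monoPerm := by
  apply extendSpine_mem_monoPerm
  rintro ⟨k, ξ⟩ ⟨l, η⟩ h
  obtain ⟨ξ, rfl | rfl⟩ := exists_eq_cons ξ <;> obtain ⟨η, rfl | rfl⟩ := exists_eq_cons η <;>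
    simp [halfShift_zero, halfShift_one, LexLT, wordLT_cons] at h ⊢ <;> omega

theorem regularAt_halfShift (p : ℤ × InfWord) :
    RegularAt (extendSpine halfShift) (spineEmb p) := by
  obtain ⟨k, ξ⟩ := p
  obtain ⟨ξ, rfl | rfl⟩ := exists_eq_cons ξ
  · refine ⟨spine k ++ [0], spine k ++ [1], ξ, ?_, fun β => ?_⟩
    · rw [spineEmb_apply, Stream'.append_append_stream]; rfl
    · rw [Stream'.append_append_stream, ← spineEmb_apply, extendSpine_apply,
        Stream'.append_eq_cons, halfShift_zero, spineEmb_apply, Stream'.append_append_stream]; rfl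
  · refine ⟨spine k ++ [1], spine (k + 1) ++ [0], ξ, ?_, fun β => ?_⟩
    · rw [spineEmb_apply, Stream'.append_append_stream]; rfl
    · rw [Stream'.append_append_stream, ← spineEmb_apply, extendSpine_apply,
        Stream'.append_eq_cons, halfShift_one, spineEmb_apply, Stream'.append_append_stream]; rfl

/-- The permutation which acts on the `k`-th interval as `f k`, and its conjugate by the half
shift. -/
def spineGen (f : ℤ → Perm InfWord) : Bool → Perm (ℤ × InfWord)
  | true => prodCongrRight f
  | false => halfShift * prodCongrRight f * halfShift⁻¹

theorem extendSpine_spineGen_mem {f : ℤ → Perm InfWord} (hf : ∀ k, f k ∈ monoPerm) (i : Bool) :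
    extendSpine (spineGen f i) ∈ monoPerm := by
  have h1 := extendSpine_prodCongrRight_mem hf
  cases i
  · rw [spineGen, map_mul, map_mul, map_inv]
    exact mul_mem (mul_mem extendSpine_halfShift_mem h1) (inv_mem extendSpine_halfShift_mem)
  · exact h1

theorem regularAt_spineGen {f : ℤ → Perm InfWord} (hf : ∀ k ξ, RegularAt (f k) ξ) (i : Bool)
    (p : ℤ × InfWord) : RegularAt (extendSpine (spineGen f i)) (spineEmb p) := by
  have h1 := regularAt_extendSpine_prodCongrRight hf
  have h2 := regularAt_halfShift
  cases i
  · rw [spineGen, map_mul, map_mul]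
    -- Writing the point as a shifted one lets the inverse shift undo it, so each of the three
    -- factors is tested at an interior word.
    obtain ⟨q, rfl⟩ := halfShift.surjective p
    have e : extendSpine halfShift⁻¹ (spineEmb (halfShift q)) = spineEmb q := by
      rw [extendSpine_apply, Perm.coe_inv, symm_apply_apply]
    refine RegularAt.mul (RegularAt.mul ?_ ?_) ?_
    · rw [e, extendSpine_apply]
      exact h2 _
    · rw [e]
      exact h1 q
    · rw [map_inv] at e ⊢
      refine RegularAt.inv ?_
      rw [e]
      exact h2 q
  · exact h1 p

/-- The inverse half shift takes the left half of interval `k` to interval `k - 1`; this costs one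
in the bound. -/
theorem spineGen_eq_self {f : ℤ → Perm InfWord} {n : ℕ} (hf : ∀ k, (n : ℤ) < |k| → f k = 1)
    (i : Bool) (k : ℤ) (ξ : InfWord) (hk : ((n + 1 : ℕ) : ℤ) < |k|) :
    spineGen f i (k, ξ) = (k, ξ) := by
  push_cast at hk
  cases i
  · obtain ⟨ξ, rfl | rfl⟩ := exists_eq_cons ξ
    · have h1 := halfShift_one (k - 1) ξ
      rw [sub_add_cancel] at h1
      have h2 : (n : ℤ) < |k - 1| := by
        have := abs_sub_abs_le_abs_sub k 1
        rw [abs_one] at this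
        linarith
      simp [spineGen, ← h1, hf _ h2]
    · have h1 := halfShift_zero k ξ
      have h2 : (n : ℤ) < |k| := by linarith
      simp [spineGen, ← h1, hf _ h2]
  · simp [spineGen, hf k (by linarith)]

/-- The half shift slides the intervals towards the end points, but after conjugation this cancels
wherever `f` is trivial. So finite support restores regularity at `000…` and `111…`. -/
theorem regularAt_spineGen_of_finite {f : ℤ → Perm InfWord} {n : ℕ}
    (hf : ∀ k ξ, RegularAt (f k) ξ) (hn : ∀ k, (n : ℤ) < |k| → f k = 1) (i : Bool) (ξ : InfWord) :
    RegularAt (extendSpine (spineGen f i)) ξ := by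
  obtain rfl | rfl | ⟨p, rfl⟩ := eq_const_or_exists_spineEmb ξ
  · exact regularAt_extendSpine_const (spineGen_eq_self hn i) 0
  · exact regularAt_extendSpine_const (spineGen_eq_self hn i) 1
  · exact regularAt_spineGen hf i p

/-- Without finite support the two constant words are the only possible irregular points, hence at
most two infinite branches are needed. -/
theorem isTreeLike_spineGen {f : ℤ → Perm InfWord} (hm : ∀ k, f k ∈ monoPerm)
    (hf : ∀ k ξ, RegularAt (f k) ξ) (i : Bool) : IsTreeLike (extendSpine (spineGen f i)) where
  mono := extendSpine_spineGen_mem hm i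
  finite := by
    refine (Set.toFinite {Stream'.const 0, Stream'.const 1}).subset fun ξ hξ => ?_
    obtain rfl | rfl | ⟨p, rfl⟩ := eq_const_or_exists_spineEmb ξ
    · simp
    · simp
    · exact (hξ (regularAt_spineGen hf i p)).elim

/-! ### Ping-pong -/

/-- The attracting sets. -/
def pingX : Bool → Set (ℤ × InfWord)
  | true => {p | ∃ ξ, p.2 = Stream'.cons 1 (Stream'.cons 1 ξ)}
  | false => {p | ∃ ξ, p.2 = Stream'.cons 0 (Stream'.cons 1 ξ)}

/-- The repelling sets. -/
def pingY : Bool → Set (ℤ × InfWord)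
  | true => {p | ∃ ξ, p.2 = Stream'.cons 0 (Stream'.cons 0 ξ)}
  | false => {p | ∃ ξ, p.2 = Stream'.cons 1 (Stream'.cons 0 ξ)}

/-- The permutation `x₀²` on all the intervals, and its conjugate by the half shift. -/
def pingGen : Bool → Perm (ℤ × InfWord) := spineGen fun _ => genX * genX

/-- The square is needed because `x₀` sends `01…` only to `10…`, and a second application brings it
into `11…`. -/
theorem pingGen_mem (i : Bool) {p : ℤ × InfWord} (hp : p ∉ pingY i) : pingGen i p ∈ pingX i := by
  have key : ∀ ξ : InfWord, (¬ ∃ α, ξ = Stream'.cons 0 (Stream'.cons 0 α)) →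
      ∃ α, (genX * genX) ξ = Stream'.cons 1 (Stream'.cons 1 α) := by
    intro ξ h
    obtain ⟨ξ, rfl | rfl⟩ := exists_eq_cons ξ
    · obtain ⟨ξ, rfl | rfl⟩ := exists_eq_cons ξ
      · exact (h ⟨_, rfl⟩).elim
      · exact ⟨_, by rw [Perm.mul_apply, genX_zero_one, genX_one]⟩
    · exact ⟨_, by rw [Perm.mul_apply, genX_one, genX_one]⟩
  cases i
  -- The half shift carries the quarter `00` to the quarter `10` of the same interval, and the
  -- quarter `11` to the quarter `01` of the next interval. These are the repelling and attracting
  -- sets of the conjugate.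
  · obtain ⟨⟨k, ξ⟩, rfl⟩ := halfShift.surjective p
    obtain ⟨α, hα⟩ := key ξ (by
      rintro ⟨α, rfl⟩
      exact hp ⟨α, by rw [halfShift_zero]⟩)
    refine ⟨α, ?_⟩
    rw [pingGen, spineGen, Perm.mul_apply, Perm.mul_apply, Perm.coe_inv, symm_apply_apply,
      prodCongrRight_apply, hα, halfShift_one]
  · obtain ⟨k, ξ⟩ := p
    exact key ξ hp

theorem pingGen_inv_mem (i : Bool) {p : ℤ × InfWord} (hp : p ∉ pingX i) :
    (pingGen i)⁻¹ p ∈ pingY i := by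
  by_contra hc
  have := pingGen_mem i hc
  simp only [Perm.coe_inv, apply_symm_apply] at this
  exact hp this

theorem disjoint_of_digits {a b c d : Fin 2} (h : a ≠ c ∨ b ≠ d) :
    Disjoint {p : ℤ × InfWord | ∃ ξ, p.2 = Stream'.cons a (Stream'.cons b ξ)}
      {p : ℤ × InfWord | ∃ ξ, p.2 = Stream'.cons c (Stream'.cons d ξ)} := by
  rw [Set.disjoint_left]
  rintro p ⟨ξ, hξ⟩ ⟨η, hη⟩
  rw [hξ] at hη
  have h1 : a = c := congrArg Stream'.head hη
  have h2 : b = d := congrArg (fun ζ => Stream'.head (Stream'.tail ζ)) hη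
  tauto

theorem disjoint_pingX : Disjoint (pingX true) (pingX false) := disjoint_of_digits (by decide)

theorem disjoint_pingY : Disjoint (pingY true) (pingY false) := disjoint_of_digits (by decide)

theorem disjoint_pingX_pingY (i j : Bool) : Disjoint (pingX i) (pingY j) := by
  cases i <;> cases j <;> exact disjoint_of_digits (by decide)

/-- The ping-pong lemma, with the four sets being the four quarters of the intervals, told apart by
two letters. -/
theorem lift_pingGen_injective : Function.Injective (FreeGroup.lift pingGen) := by
  refine FreeGroup.injective_lift_of_ping_pong pingGen pingX pingY ?_ ?_ ?_ disjoint_pingX_pingY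
    ?_ ?_
  · intro i
    cases i
    · exact ⟨(0, _), Stream'.const 0, rfl⟩
    · exact ⟨(0, _), Stream'.const 0, rfl⟩
  · intro i j hij
    cases i <;> cases j <;> first | exact (hij rfl).elim | exact disjoint_pingX |
      exact disjoint_pingX.symm
  · intro i j hij
    cases i <;> cases j <;> first | exact (hij rfl).elim | exact disjoint_pingY |
      exact disjoint_pingY.symm
  · rintro i _ ⟨p, hp, rfl⟩
    exact pingGen_mem i hp
  · rintro i _ ⟨p, hp, rfl⟩
    exact pingGen_inv_mem i hp

end Thompson


namespace Thompson

open Equiv Filter MeasureTheory Topology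

/-! ### Limits in the Hamming completion -/

/-- The pairs of a sequence in `F` and a homeomorphism which is its pointwise limit in the discrete
topology. -/
def limitPairs : Subgroup ((ℕ → thompsonF) × (unitInterval ≃ₜ unitInterval)) where
  carrier := {p | ∀ x, ∀ᶠ n in atTop, (p.1 n).1 x = p.2 x}
  one_mem' := fun _ => Eventually.of_forall fun _ => rfl
  mul_mem' := by
    intro p q hp hq x
    filter_upwards [hp (q.2 x), hq x] with n h1 h2
    change (p.1 n).1 ((q.1 n).1 x) = p.2 (q.2 x)
    rw [h2, h1]
  inv_mem' := by
    intro p hp x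
    filter_upwards [hp (p.2.symm x)] with n h
    rw [p.2.apply_symm_apply] at h
    exact (p.1 n).1.symm_apply_eq.2 h.symm

/-- These sets are open and decrease to the empty set, so continuity from above of a finite measure
applies. -/
theorem tendsto_volume_iUnion_ne (f : ℕ → unitInterval ≃ₜ unitInterval)
    (g : unitInterval ≃ₜ unitInterval) (h : ∀ x, ∀ᶠ n in atTop, f n x = g x) :
    Tendsto (fun N => (volume : Measure unitInterval).real {x | ∃ n ≥ N, f n x ≠ g x})
      atTop (𝓝 0) := by
  have hm : ∀ N, MeasurableSet {x | ∃ n ≥ N, f n x ≠ g x} := by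
    intro N
    have : {x | ∃ n ≥ N, f n x ≠ g x} = ⋃ n ≥ N, {x | f n x ≠ g x} := by
      ext x
      simp
    rw [this]
    exact (isOpen_biUnion fun n _ =>
      isOpen_ne_fun (f n).continuous g.continuous).measurableSet
  have hinter : (⋂ N, {x | ∃ n ≥ N, f n x ≠ g x}) = ∅ := by
    refine Set.eq_empty_of_forall_notMem fun x hx => ?_
    obtain ⟨N, hN⟩ := eventually_atTop.1 (h x)
    obtain ⟨n, hn, hne⟩ := Set.mem_iInter.1 hx N
    exact hne (hN n hn)
  have ht := tendsto_measure_iInter_atTop (μ := (volume : Measure unitInterval))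
    (s := fun N => {x | ∃ n ≥ N, f n x ≠ g x}) (fun N => (hm N).nullMeasurableSet)
    (fun M N hMN x ⟨n, hn, hx⟩ => ⟨n, hMN.trans hn, hx⟩) ⟨0, measure_ne_top _ _⟩
  rw [hinter, measure_empty] at ht
  exact (ENNReal.tendsto_toReal ENNReal.zero_ne_top).comp ht

/-- Where two late terms differ, one of them differs from the limit, which happens on a set of small
measure. -/
theorem isHammingCauchy_of_mem {p : (ℕ → thompsonF) × (unitInterval ≃ₜ unitInterval)}
    (hp : p ∈ limitPairs) : IsHammingCauchy p.1 := by
  have t1 := tendsto_volume_iUnion_ne (fun n => (p.1 n).1) p.2 hp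
  -- The second summand of the metric is controlled because pointwise stabilization passes to
  -- inverses.
  have t2 := tendsto_volume_iUnion_ne (fun n => ((p.1 n)⁻¹).1) p.2⁻¹ (inv_mem hp)
  intro ε hε
  have h := (t1.add t2).eventually_lt_const (by simpa using hε)
  obtain ⟨N, hN⟩ := h.exists
  refine ⟨N, fun m hm n hn => lt_of_le_of_lt ?_ hN⟩
  refine add_le_add (measureReal_mono ?_) (measureReal_mono ?_)
  all_goals
    intro x hx
    by_contra hc
    simp only [Set.mem_ofPred_eq, not_exists, not_and, not_not] at hc
    exact hx ((hc m hm).trans (hc n hn).symm)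

theorem volume_pos_of_isOpen {U : Set unitInterval} (hU : IsOpen U) (hne : U.Nonempty) :
    0 < (volume : Measure unitInterval) U := by
  obtain ⟨a, b, hab, hsub⟩ := hU.exists_Ioo_subset hne
  refine lt_of_lt_of_le ?_ (measure_mono hsub)
  rw [unitInterval.volume_Ioo]
  exact ENNReal.ofReal_pos.2 (sub_pos.2 hab)

/-- The Cauchy sequence of a pair. -/
def limitSeq : limitPairs →* hammingCauchy where
  toFun p := ⟨p.1.1, isHammingCauchy_of_mem p.2⟩
  map_one' := rfl
  map_mul' _ _ := rfl

/-- The class in the completion of a sequence with a pointwise limit. -/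
noncomputable def limitClass : limitPairs →* HammingCompletion := hammingCon.mk'.comp limitSeq

/-- A homeomorphism other than the identity moves a nonempty open set, which has positive measure.
Each of its points is moved by all late terms, so by countable subadditivity some `N` has a set of
positive measure moved by every term from `N` on. The distance to the identity then stays bounded
away from zero. -/
theorem eq_one_of_limitClass {p : limitPairs} (hp : limitClass p = 1) : p.1.2 = 1 := by
  have hcon : hammingCon (limitSeq p) 1 := hammingCon.eq.1 hp
  have ht : Tendsto (fun n => hammingDist (p.1.1 n) 1) atTop (𝓝 0) := hcon
  by_contra hne
  have hne' : ∃ x, p.1.2 x ≠ x := by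
    by_contra! hc
    exact hne (Homeomorph.ext hc)
  have hpos : 0 < (volume : Measure unitInterval) {x | p.1.2 x ≠ x} :=
    volume_pos_of_isOpen (isOpen_ne_fun p.1.2.continuous continuous_id) hne'
  have hsub : {x | p.1.2 x ≠ x} ⊆ ⋃ N, {x | ∀ n ≥ N, (p.1.1 n).1 x ≠ x} := by
    intro x hx
    obtain ⟨N, hN⟩ := eventually_atTop.1 (p.2 x)
    exact Set.mem_iUnion.2 ⟨N, fun n hn => by rw [hN n hn]; exact hx⟩
  obtain ⟨N, hN⟩ : ∃ N, (volume : Measure unitInterval) {x | ∀ n ≥ N, (p.1.1 n).1 x ≠ x} ≠ 0 := by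
    by_contra! hc
    exact hpos.ne' (measure_mono_null hsub (measure_iUnion_null hc))
  have hN' : 0 < (volume : Measure unitInterval).real {x | ∀ n ≥ N, (p.1.1 n).1 x ≠ x} :=
    ENNReal.toReal_pos hN (measure_ne_top _ _)
  obtain ⟨n, hlt, hn⟩ := ((ht.eventually_lt_const hN').and (eventually_ge_atTop N)).exists
  refine hlt.not_ge (le_add_of_le_of_nonneg (measureReal_mono fun x hx => hx n hn)
    (diffMeasure_nonneg _ _))

/-! ### Groups containing a group with a paradoxical action -/

/-- A group has no invariant mean if it contains a subgroup with a ping-pong action. -/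
theorem not_isAmenable_of_pingPong {G Γ X : Type*} [Group G] [Group Γ] [MulAction Γ X]
    (φ : Γ →* G) (hφ : Function.Injective φ) (a b : Γ) (A A' B B' : Set X) (x₀ : X)
    (hA : Disjoint A A') (hB : Disjoint B B') (hAB : Disjoint (A ∪ A') (B ∪ B'))
    (ha : ∀ x ∉ A', a • x ∈ A) (hb : ∀ x ∉ B', b • x ∈ B) : ¬ IsAmenable G := by
  rintro ⟨m, hm0, hm1, hadd, hinv⟩
  -- An equivariant map, obtained by choosing a representative in each orbit of `φ(Γ)` acting on `G`
  -- by left multiplication: if `g = φ γ * r` with `r` the representative, then `s g = γ`.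
  obtain ⟨s, hs⟩ : ∃ s : G → Γ, ∀ γ g, s (φ γ * g) = γ * s g := by
    let r : Setoid G := MulAction.orbitRel φ.range G
    have hr : ∀ g, ∃ γ : Γ, φ γ * (Quotient.mk r g).out = g := by
      intro g
      obtain ⟨⟨_, γ, rfl⟩, h⟩ := Setoid.symm' r (Quotient.mk_out (s := r) g)
      exact ⟨γ, h⟩
    choose s hs using hr
    refine ⟨s, fun γ g => hφ ?_⟩
    have e : Quotient.mk r (φ γ * g) = Quotient.mk r g :=
      Quotient.sound ⟨⟨φ γ, γ, rfl⟩, rfl⟩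
    have h1 := hs (φ γ * g)
    rw [e] at h1
    rw [← mul_left_inj (Quotient.mk r g).out, h1, map_mul, mul_assoc, hs g]
  -- The push-forward of `m` along the equivariant map `g ↦ s g • x₀`, an invariant mean on `X`.
  let M : Set X → ℝ := fun S => m {g | s g • x₀ ∈ S}
  have Mmono : ∀ {S T : Set X}, S ⊆ T → M S ≤ M T := by
    intro S T hST
    have h := hadd {g | s g • x₀ ∈ S} ({g | s g • x₀ ∈ T} \ {g | s g • x₀ ∈ S})
      Set.disjoint_sdiff_right
    rw [Set.union_sdiff_cancel (show {g | s g • x₀ ∈ S} ⊆ {g | s g • x₀ ∈ T} from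
      fun g hg => hST hg)] at h
    have := hm0 ({g | s g • x₀ ∈ T} \ {g | s g • x₀ ∈ S})
    change m _ ≤ m _
    linarith
  have Madd : ∀ {S T : Set X}, Disjoint S T → M (S ∪ T) = M S + M T := by
    intro S T hST
    refine hadd {g | s g • x₀ ∈ S} {g | s g • x₀ ∈ T} ?_
    rw [Set.disjoint_left] at hST ⊢
    exact fun g hg => hST hg
  have Muniv : M Set.univ = 1 := hm1
  have Mpre : ∀ (γ : Γ) (S : Set X), M {x | γ • x ∈ S} = M S := by
    intro γ S
    change m {g | γ • s g • x₀ ∈ S} = m {g | s g • x₀ ∈ S}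
    rw [← hinv (φ γ)]
    congr 1
    ext g
    simp only [Set.mem_image, Set.mem_ofPred_eq]
    constructor
    · rintro ⟨g, hg, rfl⟩
      rw [hs, mul_smul]
      exact hg
    · intro hg
      refine ⟨φ γ⁻¹ * g, ?_, by simp⟩
      rw [hs, mul_smul, smul_inv_smul]
      exact hg
  have key : ∀ (γ : Γ) (S T : Set X), Disjoint S T → (∀ x ∉ T, γ • x ∈ S) → 1 ≤ M (S ∪ T) := by
    intro γ S T hST h
    -- By hypothesis `Tᶜ` lies in the preimage of `S` under `γ`, which has the same mass as `S`.
    have h1 : M Tᶜ ≤ M S := by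
      rw [← Mpre γ S]
      exact Mmono h
    have h2 := Madd (disjoint_compl_right (a := T))
    rw [Set.union_compl_self, Muniv] at h2
    rw [Madd hST]
    linarith
  have h1 := key a A A' hA ha
  have h2 := key b B B' hB hb
  -- Two disjoint sets of mass at least one do not fit into total mass one.
  have h3 := Mmono (Set.subset_univ ((A ∪ A') ∪ (B ∪ B')))
  rw [Madd hAB, Muniv] at h3
  linarith

/-! ### The free group in `𝓕` and in the completion -/

/-- The ping-pong generators as permutations of the infinite words. -/
noncomputable def monoGen (i : Bool) : monoPerm :=
  ⟨extendSpine (pingGen i),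
    extendSpine_spineGen_mem (fun _ => mul_mem genX_mem_monoPerm genX_mem_monoPerm) i⟩

theorem regularAt_genX_mul_genX (ξ : InfWord) : RegularAt (genX * genX : Perm InfWord) ξ :=
  (regularAt_genX _).mul (regularAt_genX ξ)

/-- The free group acting on `[0,1]`. -/
noncomputable def freeHomeo : FreeGroup Bool →* (unitInterval ≃ₜ unitInterval) :=
  inducedHomeo.comp (FreeGroup.lift monoGen)

theorem freeHomeo_of (i : Bool) : freeHomeo (FreeGroup.of i) = inducedHomeo (monoGen i) := by
  simp [freeHomeo]

/-- Freeness passes from the spine to the words by extension, and from the words to `[0,1]` by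
`inducedHomeo_injective`. -/
theorem freeHomeo_injective : Function.Injective freeHomeo := by
  have e : monoPerm.subtype.comp (FreeGroup.lift monoGen) =
      extendSpine.comp (FreeGroup.lift pingGen) := by
    ext1 i
    simp [monoGen]
  have h : Function.Injective (monoPerm.subtype.comp (FreeGroup.lift monoGen)) := by
    rw [e]
    exact (Perm.viaEmbeddingHom_injective spineEmb).comp lift_pingGen_injective
  rw [MonoidHom.coe_comp] at h
  exact inducedHomeo_injective.comp h.of_comp

/-- The free group in `𝓕`. -/
noncomputable def freeTree : FreeGroup Bool →* treeGroup :=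
  FreeGroup.lift fun i => ⟨inducedHomeo (monoGen i), inducedHomeo_mem_treeGroup
    (isTreeLike_spineGen (fun _ => mul_mem genX_mem_monoPerm genX_mem_monoPerm)
      (fun _ => regularAt_genX_mul_genX) i)⟩

theorem freeTree_injective : Function.Injective freeTree := by
  have e : treeGroup.subtype.comp freeTree = freeHomeo := by
    ext1 i
    simp [freeTree, freeHomeo_of]
  have h := freeHomeo_injective
  rw [← e, MonoidHom.coe_comp] at h
  exact h.of_comp

/-! ### Approximation by elements of `F`, and the free group in the completion -/

/-- `x₀²` on the intervals with index at most `n`. -/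
def cutoff (n : ℕ) (k : ℤ) : Perm InfWord := if (n : ℤ) < |k| then 1 else genX * genX

theorem cutoff_mem_monoPerm (n : ℕ) (k : ℤ) : cutoff n k ∈ monoPerm := by
  unfold cutoff
  split_ifs
  · exact one_mem _
  · exact mul_mem genX_mem_monoPerm genX_mem_monoPerm

theorem regularAt_cutoff (n : ℕ) (k : ℤ) (ξ : InfWord) : RegularAt (cutoff n k) ξ := by
  unfold cutoff
  split_ifs
  · exact regularAt_one ξ
  · exact regularAt_genX_mul_genX ξ

/-- Elements of `F` approximating the ping-pong generators. -/
noncomputable def approxGen (i : Bool) (n : ℕ) : thompsonF :=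
  ⟨inducedHomeo ⟨extendSpine (spineGen (cutoff n) i),
      extendSpine_spineGen_mem (cutoff_mem_monoPerm n) i⟩,
    isThompson_inducedHomeo (regularAt_spineGen_of_finite (n := n) (regularAt_cutoff n)
      (fun _ hk => if_pos hk) i)⟩

/-- At a given point only one interval matters, and `n ≥ |k|` puts it within the cutoff. For the
conjugate it is the interval of `halfShift⁻¹ p`. -/
theorem eventually_spineGen_cutoff (i : Bool) (p : ℤ × InfWord) :
    ∀ᶠ n in atTop, spineGen (cutoff n) i p = pingGen i p := by
  have key : ∀ q : ℤ × InfWord, ∀ᶠ n in atTop,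
      prodCongrRight (cutoff n) q = prodCongrRight (fun _ => genX * genX) q := by
    rintro ⟨k, ξ⟩
    filter_upwards [eventually_ge_atTop k.natAbs] with n hn
    rw [prodCongrRight_apply, prodCongrRight_apply, cutoff, if_neg (by rw [Int.abs_eq_natAbs]; omega)]
  cases i
  · filter_upwards [key (halfShift⁻¹ p)] with n hn
    simp only [pingGen, spineGen, Perm.mul_apply, hn]
  · exact key p

theorem approxGen_mem_limitPairs (i : Bool) :
    (approxGen i, inducedHomeo (monoGen i)) ∈ limitPairs := by
  intro x
  obtain ⟨ξ, rfl⟩ := val_surjective x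
  simp only [approxGen, inducedHomeo_val, monoGen]
  obtain rfl | rfl | ⟨p, rfl⟩ := eq_const_or_exists_spineEmb ξ
  · simp only [extendSpine_const, eventually_true]
  · simp only [extendSpine_const, eventually_true]
  · filter_upwards [eventually_spineGen_cutoff i p] with n hn
    rw [extendSpine_apply, extendSpine_apply, hn]

/-- The free group in the completion. -/
noncomputable def freeLimit : FreeGroup Bool →* limitPairs :=
  FreeGroup.lift fun i => ⟨_, approxGen_mem_limitPairs i⟩

/-- The pointwise limit of the sequence attached to a word of the free group is its image under
`freeHomeo`, and a trivial class forces this limit to be the identity. -/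
theorem limitClass_comp_freeLimit_injective :
    Function.Injective (limitClass.comp freeLimit) := by
  have e : (MonoidHom.snd _ _).comp (limitPairs.subtype.comp freeLimit) = freeHomeo := by
    ext1 i
    simp [freeLimit, freeHomeo_of]
  rw [injective_iff_map_eq_one]
  intro w hw
  have h : freeHomeo w = 1 := by
    rw [← e]
    exact eq_one_of_limitClass hw
  exact (injective_iff_map_eq_one _).1 freeHomeo_injective w h

theorem not_isAmenable_hammingCompletion : ¬ IsAmenable HammingCompletion := by
  -- The mean is transported to the spine, where the ping-pong takes place; no action of the
  -- completion itself is used.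
  let _ : MulAction (FreeGroup Bool) (ℤ × InfWord) :=
    MulAction.compHom _ (FreeGroup.lift pingGen)
  have hsmul : ∀ i p, FreeGroup.of i • p = pingGen i p := by
    intro i p
    change FreeGroup.lift pingGen (FreeGroup.of i) p = _
    rw [FreeGroup.lift_apply_of]
  refine not_isAmenable_of_pingPong (limitClass.comp freeLimit) limitClass_comp_freeLimit_injective
    (FreeGroup.of true) (FreeGroup.of false) (pingX true) (pingY true) (pingX false) (pingY false)
    (0, Stream'.const 0) (disjoint_pingX_pingY _ _) (disjoint_pingX_pingY _ _) ?_ ?_ ?_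
  · rw [Set.disjoint_union_left, Set.disjoint_union_right, Set.disjoint_union_right]
    exact ⟨⟨disjoint_pingX, disjoint_pingX_pingY _ _⟩, (disjoint_pingX_pingY _ _).symm,
      disjoint_pingY⟩
  · intro p hp
    rw [hsmul]
    exact pingGen_mem true hp
  · intro p hp
    rw [hsmul]
    exact pingGen_mem false hp

end Thompson

/-! ### The theorem -/

theorem theoremt :
    (∃ H : Subgroup Thompson.treeGroup, IsFreeGroup H ∧ ∃ a b : H, a * b ≠ b * a) ∧
      ¬ Thompson.IsAmenable Thompson.HammingCompletion := by
  refine ⟨⟨Thompson.freeTree.range,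
    IsFreeGroup.ofMulEquiv (MonoidHom.ofInjective Thompson.freeTree_injective),
    ⟨_, FreeGroup.of true, rfl⟩, ⟨_, FreeGroup.of false, rfl⟩, fun h => ?_⟩,
    Thompson.not_isAmenable_hammingCompletion⟩
  have h1 : Thompson.freeTree (FreeGroup.of true * FreeGroup.of false) =
      Thompson.freeTree (FreeGroup.of false * FreeGroup.of true) := by
    rw [map_mul, map_mul]
    exact congrArg Subtype.val h
  -- Equality in the free group is decided by comparing reduced words.
  exact absurd (Thompson.freeTree_injective h1) (by decide)
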